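/- Let $E\to M$ be a smooth real vector bundle of positive rank over a smooth manifold. Let $\mathfrak{D}E$ be its gauge Lie algebroid (sections: $\mathbb R$-linear operators $\mathfrak d$ on $\Gamma(E)$ with $\mathfrak d(fu)=f\,\mathfrak du+\alpha(\mathfrak d)(f)u$, $\alpha(\mathfrak d)\in\mathfrak X(M)$), let $\mathfrak{J}E$ be its first jet bundle, $\mathbb p:\mathfrak JE\to E$ the projection, $\mathbb d u\in\Gamma(\mathfrak JE)$ the jet of $u\in\Gamma(E)$, and $\langle\cdot,\cdot\rangle_E$ the $E$-valued pairing of $\mathfrak JE$ and $\mathfrak DE$ with $\langle\mathbb d u,\mathfrak d\rangle_E=\mathfrak d u$. Put $\langle\mathfrak L_{\mathfrak d}\mu,\mathfrak r\rangle_E=\mathfrak d\langle\mu,\mathfrak r\rangle_E-\langle\mu,[\mathfrak d,\mathfrak r]\rangle_E$. On $\mathcal E=\mathfrak DE\oplus\mathfrak JE$, with projection $\rho:\mathcal E\to\mathfrak DE$, consider $$\{\mathfrak d+\mu,\mathfrak r+\nu\}=[\mathfrak d,\mathfrak r]+\mathfrak L_{\mathfrak d}\nu-\mathfrak L_{\mathfrak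 r}\mu+\mathbb d\langle\mu,\mathfrak r\rangle_E,\qquad (\mathfrak d+\mu,\mathfrak r+\nu)_E=\tfrac12(\langle\mathfrak d,\nu\rangle_E+\langle\mathfrak r,\mu\rangle_E).$$ Let $\mathcal T=TM\oplus E$ and $\mathbf b:\mathcal E\to\mathcal T$, $\mathbf b(\mathfrak d+\mu)=\alpha(\mathfrak d)+\mathbb p(\mu)$; its kernel is identified with $\mathrm{Hom}(\mathcal T,E)=\mathfrak{gl}(E)\oplus\mathrm{Hom}(TM,E)$. For $X\in\Gamma(\mathcal E)$ the falling $\overline X$ is the operator on $\Gamma(\mathcal T)$ given by $\overline X(t)=\mathbf b\{X,Y\}$ for any $Y$ with $\mathbf b(Y)=t$. For a subbundle $C\subset\mathcal E$ let $N_C=\{X\in\Gamma(\mathcal E)\mid\{X,Y\}\in\Gamma(C)\ \forall Y\in\Gamma(C)\}$. Let $A\subset\mathcal T$ be a projective Lie algebroid, i.e. a subbundle with a Lie algebroid structure $[\cdot,\cdot]_A$ whose anchor is the projection to $TM$. Let $A^0=\{h\in\mathrm{Hom}(\mathcal T,E)\mid h(A)=0\}\subset\mathcal E$, and let $L^A\subset\mathbf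 b^{-1}(A)$ be the lifted Dirac structure: its sections are the $X\in\Gamma(\mathbf b^{-1}(A))$ with $\mathbf b\{X,Y\}=[\mathbf bX,\mathbf bY]_A$ for all $Y\in\Gamma(\mathbf b^{-1}(A))$. $L^A$ is a Lie algebroid with the bracket $\{\cdot,\cdot\}$, represented on $E$ by $\rho|_{L^A}$; let $d_{L^A}$ be the corresponding coboundary operator and $\omega_X=(X,\cdot)_E:L^A\to E$ for $X\in\Gamma(\mathcal E)$. A bundle map $\Omega:A\wedge A\to A\cap E$ is said to generate a deformation of $A$ if for every $\varepsilon\in\mathbb R$ the bracket $[a,b]_A+\varepsilon\,\Omega(a,b)$ makes $A$ a projective Lie algebroid. Write $(\mathbf b^*\Omega)(l_1,l_2)=\Omega(\mathbf bl_1,\mathbf bl_2)$. **Proposition 6.5.** One has $N_{A^0}=N_{\mathbf b^{-1}(A)}$. Let $\Omega:A\wedge A\to A\cap E$ be a bundle map with $$\mathbf b^*\Omega=d_{L^A}\omega_X\qquad(1)$$ for some $X\in\Gamma(\mathcal E)$. Then $X\in N_{A^0}=N_{\mathbf b^{-1}(A)}$ (so that $\overline X$ preserves $\Gamma(A)$),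 and $$\Omega(a_1,a_2)=\tfrac12\big([\overline Xa_1,a_2]_A+[a_1,\overline Xa_2]_A-\overline X[a_1,a_2]_A\big)\qquad\forall\,a_1,a_2\in\Gamma(A).\qquad(2)$$ Furthermore, $\Omega$ generates a deformation of $A$ if and only if $$[T^X(a,b),c]_A+T^X([a,b]_A,c)+\text{c.p.}=0\qquad\forall\,a,b,c\in\Gamma(A),\qquad(3)$$ where c.p. stands for the cyclic permutations of $a,b,c$ and $$T^X(a,b)=\overline X\big([\overline Xa,b]_A+[a,\overline Xb]_A-\overline X[a,b]_A\big)-[\overline Xa,\overline Xb]_A.$$ Conversely, for any $X\in N_{\mathbf b^{-1}(A)}=N_{A^0}$ satisfying (3), formula (2) defines a bundle map $\Omega:A\wedge A\to A\cap E$ that generates a deformation of $A$ and satisfies (1). -/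

import Mathlib

open Bundle VectorField Filter
open scoped Manifold ContDiff Topology

noncomputable section

namespace OmniLie

variable {B : Type*} [NormedAddCommGroup B] [NormedSpace ℝ B]
  {H : Type*} [TopologicalSpace H] (I : ModelWithCorners ℝ B H)
  {M : Type*} [TopologicalSpace M] [ChartedSpace H M]

/-! ### Smooth functions, vector fields and sections -/

section Module

variable {I} {F : Type*} [NormedAddCommGroup F] [NormedSpace ℝ F]
  {V : M → Type*} [TopologicalSpace (TotalSpace F V)]
  [∀ x, AddCommGroup (V x)] [∀ x, Module ℝ (V x)] [∀ x : M, TopologicalSpace (V x)]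
  [FiberBundle F V] [VectorBundle ℝ F V]

/-- Pointwise multiplication of a smooth section by a smooth function. -/
instance sectionSMul : SMul C^∞⟮I, M; ℝ⟯ Cₛ^∞⟮I; F, V⟯ :=
  ⟨fun f s => ⟨fun x => f x • s x, f.contMDiff.smul_section s.contMDiff⟩⟩

@[simp]
theorem section_smul_apply (f : C^∞⟮I, M; ℝ⟯) (s : Cₛ^∞⟮I; F, V⟯) (x : M) :
    (f • s) x = f x • s x := rfl

/-- Smooth sections form a module over the ring of smooth functions. -/
instance sectionModule : Module C^∞⟮I, M; ℝ⟯ Cₛ^∞⟮I; F, V⟯ where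
  one_smul s := by ext x; exact one_smul ℝ (s x)
  mul_smul f g s := by ext x; exact mul_smul (f x) (g x) (s x)
  smul_zero f := by ext x; exact smul_zero (f x)
  smul_add f s t := by ext x; exact smul_add (f x) (s x) (t x)
  add_smul f g s := by ext x; exact add_smul (f x) (g x) (s x)
  zero_smul s := by ext x; exact zero_smul ℝ (s x)

instance sectionTower : IsScalarTower ℝ C^∞⟮I, M; ℝ⟯ Cₛ^∞⟮I; F, V⟯ :=
  ⟨fun r f s => by ext x; exact smul_assoc r (f x) (s x)⟩

instance sectionComm : SMulCommClass ℝ C^∞⟮I, M; ℝ⟯ Cₛ^∞⟮I; F, V⟯ :=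
  ⟨fun r f s => by ext x; exact smul_comm r (f x) (s x)⟩

instance sectionComm' : SMulCommClass C^∞⟮I, M; ℝ⟯ ℝ Cₛ^∞⟮I; F, V⟯ :=
  ⟨fun f r s => by ext x; exact smul_comm (f x) r (s x)⟩

end Module

/-- Smooth vector fields on `M`. -/
abbrev VF (M : Type*) [TopologicalSpace M] [ChartedSpace H M] [IsManifold I ∞ M] : Type _ :=
  Cₛ^∞⟮I; B, (TangentSpace I : M → Type _)⟯

variable {I} [IsManifold I ∞ M]

/-- The derivative `x(f)` of a smooth function along a vector field. -/
def VF.deriv (x : VF I M) (f : C^∞⟮I, M; ℝ⟯) : C^∞⟮I, M; ℝ⟯ where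
  val m := mvfderiv I f m (x m)
  property := by
    have h1 : ContMDiff I.tangent 𝓘(ℝ, ℝ).tangent ∞ (tangentMap I 𝓘(ℝ, ℝ) f) :=
      f.contMDiff.contMDiff_tangentMap (by simp)
    exact ((contMDiff_snd_tangentBundle_modelSpace ℝ 𝓘(ℝ, ℝ)).comp h1).comp x.contMDiff

variable [FiniteDimensional ℝ B]

/-- The Lie bracket of two smooth vector fields. -/
def VF.bracket (x y : VF I M) : VF I M :=
  ⟨mlieBracket I x y, by
    have := FiniteDimensional.complete ℝ B
    have : IsManifold I (minSmoothness ℝ 2) M := by simpa using (inferInstance : IsManifold I 2 M)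
    have : IsManifold I ((⊤ : ℕ∞) + 1) M := by simpa using! (inferInstance : IsManifold I ∞ M)
    exact ContDiff.mlieBracket_vectorField (m := ⊤) (n := ⊤) x.contMDiff y.contMDiff (by simp)⟩

end OmniLie
namespace OmniLie
section
variable {B : Type*} [NormedAddCommGroup B] [NormedSpace ℝ B]
  {H : Type*} [TopologicalSpace H] {I : ModelWithCorners ℝ B H}
  {M : Type*} [TopologicalSpace M] [ChartedSpace H M]

theorem mdiffAt_fun (f : C^∞⟮I, M; ℝ⟯) (m : M) : MDiffAt f m :=
  f.contMDiff.mdifferentiable (by simp) m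

variable [IsManifold I ∞ M]

theorem VF.deriv_apply (x : VF I M) (f : C^∞⟮I, M; ℝ⟯) (m : M) :
    x.deriv f m = mvfderiv I f m (x m) := rfl

theorem VF.add_deriv (x y : VF I M) (f : C^∞⟮I, M; ℝ⟯) :
    (x + y).deriv f = x.deriv f + y.deriv f := by
  ext m; exact map_add (mvfderiv I f m) (x m) (y m)

theorem VF.smul_deriv (g : C^∞⟮I, M; ℝ⟯) (x : VF I M) (f : C^∞⟮I, M; ℝ⟯) :
    (g • x).deriv f = g * x.deriv f := by
  ext m; exact map_smul (mvfderiv I f m) (g m) (x m)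

theorem VF.zero_deriv (f : C^∞⟮I, M; ℝ⟯) : (0 : VF I M).deriv f = 0 := by
  ext m; exact map_zero (mvfderiv I f m)

theorem VF.deriv_mul (x : VF I M) (f g : C^∞⟮I, M; ℝ⟯) :
    x.deriv (f * g) = f * x.deriv g + g * x.deriv f := by
  ext m
  have h := mvfderiv_mul (mdiffAt_fun (I := I) f m) (mdiffAt_fun g m)
  have h2 := congrArg (fun φ : TangentSpace I m →L[ℝ] ℝ => φ (x m)) h
  simpa [VF.deriv_apply] using! h2

theorem VF.deriv_const_smul (x : VF I M) (r : ℝ) (f : C^∞⟮I, M; ℝ⟯) :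
    x.deriv (r • f) = r • x.deriv f := by
  ext m
  have h := mvfderiv_smul (mdifferentiableAt_const (I := I) (c := r) (x := m)) (mdiffAt_fun f m)
  have h2 := congrArg (fun φ : TangentSpace I m →L[ℝ] ℝ => φ (x m)) h
  simpa [VF.deriv_apply, mvfderiv_const] using! h2

variable [FiniteDimensional ℝ B]

theorem VF.bracket_apply (x y : VF I M) (m : M) : x.bracket y m = mlieBracket I x y m := rfl

theorem VF.bracket_skew (x y : VF I M) : x.bracket y = - y.bracket x := by
  ext m; exact mlieBracket_swap_apply

theorem VF.bracket_add (x y z : VF I M) : x.bracket (y + z) = x.bracket y + x.bracket z := by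
  have := FiniteDimensional.complete ℝ B
  ext m; exact mlieBracket_add_right (y.mdifferentiableAt) (z.mdifferentiableAt)

theorem VF.bracket_smul (x y : VF I M) (f : C^∞⟮I, M; ℝ⟯) :
    x.bracket (f • y) = f • x.bracket y + x.deriv f • y := by
  have := FiniteDimensional.complete ℝ B
  ext m
  have h := mlieBracket_smul_right (V := x) (mdiffAt_fun f m) (y.mdifferentiableAt (x := m))
  rw [add_comm] at h
  exact h

theorem VF.jacobi (x y z : VF I M) :
    x.bracket (y.bracket z) = (x.bracket y).bracket z + y.bracket (x.bracket z) := by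
  have := FiniteDimensional.complete ℝ B
  have : IsManifold I (minSmoothness ℝ 3) M := by simpa using (inferInstance : IsManifold I 3 M)
  ext m
  refine leibniz_identity_mlieBracket_apply ?_ ?_ ?_ <;> simp only [minSmoothness_of_isRCLikeNormedField]
  · exact (x.contMDiff m).of_le ENat.LEInfty.out
  · exact (y.contMDiff m).of_le ENat.LEInfty.out
  · exact (z.contMDiff m).of_le ENat.LEInfty.out

section
variable {F : Type*} [NormedAddCommGroup F] [NormedSpace ℝ F]
  {V : M → Type*} [TopologicalSpace (TotalSpace F V)]
  [∀ x, AddCommGroup (V x)] [∀ x, Module ℝ (V x)] [∀ x : M, TopologicalSpace (V x)]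
  [FiberBundle F V] [VectorBundle ℝ F V] [T2Space M]

/-- A smooth cut-off function at `m`, supported in a given neighbourhood of `m`. -/
theorem exists_cutoff {m : M} {s : Set M} (hs : s ∈ 𝓝 m) :
    ∃ ψ : C^∞⟮I, M; ℝ⟯, ψ m = 1 ∧ tsupport ψ ⊆ s := by
  obtain ⟨f, -, hf⟩ := (SmoothBumpFunction.nhds_basis_tsupport (I := I) m).mem_iff.1 hs
  exact ⟨⟨f, f.contMDiff⟩, f.eq_one, hf⟩

/-- Every vector of a smooth vector bundle is a value of a global smooth section. -/
theorem exists_section [ContMDiffVectorBundle ∞ F V I] {m : M} (v : V m) :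
    ∃ s : Cₛ^∞⟮I; F, V⟯, s m = v := by
  obtain ⟨u, hu, h⟩ := FiberBundle.exists_contMDiffOn_extend (k := ∞) I F v
  obtain ⟨w, hw, hwo, hmw⟩ := mem_nhds_iff.1 hu
  obtain ⟨ψ, h1, h2⟩ := exists_cutoff (I := I) (hwo.mem_nhds hmw)
  refine ⟨⟨_, ContMDiffOn.smul_section_of_tsupport ψ.contMDiff.contMDiffOn hwo h2 (h.mono hw)⟩, ?_⟩
  simp [h1]
end

theorem VF.bracket_deriv [T2Space M] (x y : VF I M) (f : C^∞⟮I, M; ℝ⟯) :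
    (x.bracket y).deriv f = x.deriv (y.deriv f) - y.deriv (x.deriv f) := by
  ext m
  rcases subsingleton_or_nontrivial B with hB | hB
  · have h (z : VF I M) (g : C^∞⟮I, M; ℝ⟯) : z.deriv g m = 0 := by
      rw [VF.deriv_apply, (Subsingleton.elim (α := B) (z m) 0 : z m = 0)]; exact map_zero _
    exact (h _ _).trans ((congrArg₂ (· - ·) (h x _) (h y _)).trans (sub_zero 0)).symm
  · obtain ⟨v, hv⟩ := exists_ne (0 : B)
    obtain ⟨u, hu⟩ := exists_section (I := I) (F := B) (V := (TangentSpace I : M → Type _)) (m := m) v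
    have h := VF.jacobi x y (f • u)
    simp only [VF.bracket_smul, VF.bracket_add] at h
    rw [VF.jacobi x y u] at h
    have h2 : ((x.bracket y).deriv f - (x.deriv (y.deriv f) - y.deriv (x.deriv f))) • u = 0 := by
      rw [smul_add] at h
      simp only [sub_smul]
      refine Eq.trans ?_ (neg_eq_zero.2 (sub_eq_zero.2 h))
      abel
    have h3 := congrArg (fun s : VF I M => s m) h2
    have h4 : ((x.bracket y).deriv f - (x.deriv (y.deriv f) - y.deriv (x.deriv f))) m • v = 0 := by
      rw [← hu]; exact h3
    exact sub_eq_zero.1 ((smul_eq_zero.1 h4).resolve_right hv)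
end
end OmniLie
namespace OmniLie

variable {B : Type*} [NormedAddCommGroup B] [NormedSpace ℝ B]
  {H : Type*} [TopologicalSpace H] (I : ModelWithCorners ℝ B H)
  {M : Type*} [TopologicalSpace M] [ChartedSpace H M] [IsManifold I ∞ M]
  (F : Type*) [NormedAddCommGroup F] [NormedSpace ℝ F]
  (E : M → Type*) [TopologicalSpace (TotalSpace F E)]
  [∀ x, AddCommGroup (E x)] [∀ x, Module ℝ (E x)] [∀ x : M, TopologicalSpace (E x)]
  [FiberBundle F E] [VectorBundle ℝ F E]

/-! ### The gauge algebroid and the jet bundle, through their sections -/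

/-- `Γ(𝔇E)`: a section of the gauge Lie algebroid of `E` is a derivation of `E`, that is, an
`ℝ`-linear operator `𝔡` on `Γ(E)` with a symbol `x ∈ 𝔛(M)`: `𝔡(fu) = f 𝔡u + x(f) u`.
It is stored as the pair `(x, 𝔡)`. -/
def gaugeSubmodule : Submodule C^∞⟮I, M; ℝ⟯ (VF I M × (Cₛ^∞⟮I; F, E⟯ →ₗ[ℝ] Cₛ^∞⟮I; F, E⟯)) where
  carrier := {d | ∀ (f : C^∞⟮I, M; ℝ⟯) (u : Cₛ^∞⟮I; F, E⟯), d.2 (f • u) = f • d.2 u + d.1.deriv f • u}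
  zero_mem' f u := by simp [VF.zero_deriv]
  add_mem' {a b} ha hb f u := by
    have h1 := ha f u
    have h2 := hb f u
    simp only [Prod.snd_add, Prod.fst_add, LinearMap.add_apply, VF.add_deriv, h1, h2, smul_add,
      add_smul]
    abel
  smul_mem' g a ha f u := by
    have h1 := ha f u
    simp only [Prod.smul_snd, Prod.smul_fst, LinearMap.smul_apply, VF.smul_deriv, h1, smul_add,
      mul_smul]
    rw [smul_comm g f]

/-- The `C^∞(M)`-module `Γ(𝔇E)`. -/
abbrev GaugeSec : Type _ := gaugeSubmodule I F E

variable {I F E}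

namespace GaugeSec

/-- The anchor `α : Γ(𝔇E) → 𝔛(M)`. -/
def anchor (d : GaugeSec I F E) : VF I M := d.1.1

/-- The operator on `Γ(E)`. -/
def op (d : GaugeSec I F E) : Cₛ^∞⟮I; F, E⟯ →ₗ[ℝ] Cₛ^∞⟮I; F, E⟯ := d.1.2

theorem op_smul (d : GaugeSec I F E) (f : C^∞⟮I, M; ℝ⟯) (u : Cₛ^∞⟮I; F, E⟯) :
    d.op (f • u) = f • d.op u + d.anchor.deriv f • u := d.2 f u

theorem ext' {d r : GaugeSec I F E} (h1 : d.anchor = r.anchor) (h2 : ∀ u, d.op u = r.op u) :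
    d = r := Subtype.ext (Prod.ext h1 (LinearMap.ext h2))

@[simp] theorem anchor_add (d r : GaugeSec I F E) : (d + r).anchor = d.anchor + r.anchor := rfl
@[simp] theorem anchor_smul (f : C^∞⟮I, M; ℝ⟯) (d : GaugeSec I F E) :
    (f • d).anchor = f • d.anchor := rfl
@[simp] theorem op_add_apply (d r : GaugeSec I F E) (u : Cₛ^∞⟮I; F, E⟯) :
    (d + r).op u = d.op u + r.op u := rfl
@[simp] theorem op_smul_apply (f : C^∞⟮I, M; ℝ⟯) (d : GaugeSec I F E) (u : Cₛ^∞⟮I; F, E⟯) :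
    (f • d).op u = f • d.op u := rfl

variable (I F E) in
/-- The identity `1_E ∈ Γ(gl E) ⊂ Γ(𝔇E)`. -/
def one : GaugeSec I F E := ⟨(0, LinearMap.id), fun f u => by simp [VF.zero_deriv]⟩

@[simp] theorem anchor_one : (one I F E).anchor = 0 := rfl
@[simp] theorem op_one (u : Cₛ^∞⟮I; F, E⟯) : (one I F E).op u = u := rfl

variable [FiniteDimensional ℝ B] [T2Space M]

/-- The Lie bracket of `Γ(𝔇E)`: the commutator of operators. -/
def bracket (d r : GaugeSec I F E) : GaugeSec I F E :=
  ⟨(d.anchor.bracket r.anchor, d.op ∘ₗ r.op - r.op ∘ₗ d.op), fun f u => by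
    simp only [LinearMap.sub_apply, LinearMap.comp_apply, op_smul, map_add, VF.bracket_deriv,
      smul_sub, sub_smul]
    abel⟩

@[simp] theorem anchor_bracket (d r : GaugeSec I F E) :
    (d.bracket r).anchor = d.anchor.bracket r.anchor := rfl
@[simp] theorem op_bracket (d r : GaugeSec I F E) (u : Cₛ^∞⟮I; F, E⟯) :
    (d.bracket r).op u = d.op (r.op u) - r.op (d.op u) := rfl

theorem bracket_add (d r s : GaugeSec I F E) :
    d.bracket (r + s) = d.bracket r + d.bracket s := by
  refine ext' (VF.bracket_add _ _ _) fun u => ?_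
  simp only [op_bracket, op_add_apply, map_add]
  abel

theorem bracket_smul (d r : GaugeSec I F E) (f : C^∞⟮I, M; ℝ⟯) :
    d.bracket (f • r) = f • d.bracket r + d.anchor.deriv f • r := by
  refine ext' (VF.bracket_smul _ _ _) fun u => ?_
  simp only [op_bracket, op_add_apply, op_smul_apply, op_smul, smul_sub]
  abel

end GaugeSec

variable (I F E) in
/-- `Γ(𝔍E)`, where the first jet bundle is described as
`{ν ∈ Hom(𝔇E, E) | ν(Φ) = Φ(ν(1_E)) for Φ ∈ gl(E)}`; the jet of `u` corresponds to `𝔡 ↦ 𝔡u`.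
Sections of `gl(E)` are the sections of `𝔇E` with vanishing symbol. -/
def jetSubmodule : Submodule C^∞⟮I, M; ℝ⟯ (GaugeSec I F E →ₗ[C^∞⟮I, M; ℝ⟯] Cₛ^∞⟮I; F, E⟯) where
  carrier := {ν | ∀ Φ : GaugeSec I F E, Φ.anchor = 0 → ν Φ = Φ.op (ν (GaugeSec.one I F E))}
  zero_mem' Φ _ := by simp
  add_mem' {a b} ha hb Φ h := by
    simp only [LinearMap.add_apply, map_add, ← ha Φ h, ← hb Φ h]
  smul_mem' f a ha Φ h := by
    simp only [LinearMap.smul_apply, GaugeSec.op_smul, h, VF.zero_deriv, zero_smul, add_zero,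
      ← ha Φ h]

variable (I F E) in
/-- The `C^∞(M)`-module `Γ(𝔍E)`. -/
abbrev JetSec : Type _ := jetSubmodule I F E

namespace JetSec

/-- The `E`-valued pairing `⟨μ, 𝔡⟩_E` of `𝔍E` and `𝔇E`. -/
def pair (μ : JetSec I F E) (d : GaugeSec I F E) : Cₛ^∞⟮I; F, E⟯ := μ.1 d

/-- The projection `𝕡 : Γ(𝔍E) → Γ(E)`. -/
def proj (μ : JetSec I F E) : Cₛ^∞⟮I; F, E⟯ := μ.pair (GaugeSec.one I F E)

/-- The jet prolongation `𝕕u ∈ Γ(𝔍E)` of `u ∈ Γ(E)`. -/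
def jet (u : Cₛ^∞⟮I; F, E⟯) : JetSec I F E :=
  ⟨{ toFun := fun d => d.op u
     map_add' := fun _ _ => rfl
     map_smul' := fun _ _ => rfl }, fun _ _ => rfl⟩

@[simp] theorem pair_jet (u : Cₛ^∞⟮I; F, E⟯) (d : GaugeSec I F E) : (jet u).pair d = d.op u := rfl
@[simp] theorem proj_jet (u : Cₛ^∞⟮I; F, E⟯) : (jet u).proj = u := rfl

theorem pair_vert (μ : JetSec I F E) {Φ : GaugeSec I F E} (h : Φ.anchor = 0) :
    μ.pair Φ = Φ.op μ.proj := μ.2 Φ h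

@[simp] theorem pair_add (μ ν : JetSec I F E) (d : GaugeSec I F E) :
    (μ + ν).pair d = μ.pair d + ν.pair d := rfl
@[simp] theorem pair_sub (μ ν : JetSec I F E) (d : GaugeSec I F E) :
    (μ - ν).pair d = μ.pair d - ν.pair d := rfl
@[simp] theorem proj_add (μ ν : JetSec I F E) : (μ + ν).proj = μ.proj + ν.proj := rfl
@[simp] theorem proj_sub (μ ν : JetSec I F E) : (μ - ν).proj = μ.proj - ν.proj := rfl

variable [FiniteDimensional ℝ B] [T2Space M]

/-- The Lie derivative `⟨𝔏_𝔡 μ, 𝔯⟩ = 𝔡⟨μ, 𝔯⟩ - ⟨μ, [𝔡, 𝔯]⟩`. -/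
def lieDeriv (d : GaugeSec I F E) (μ : JetSec I F E) : JetSec I F E :=
  ⟨{ toFun := fun r => d.op (μ.1 r) - μ.1 (d.bracket r)
     map_add' := fun r s => by
       simp only [map_add, GaugeSec.bracket_add]
       abel
     map_smul' := fun f r => by
       simp only [map_smul, map_add, GaugeSec.bracket_smul, GaugeSec.op_smul, RingHom.id_apply,
         smul_sub]
       abel }, fun Φ h => by
    have h1 : (d.bracket Φ).anchor = 0 := by
      rw [GaugeSec.anchor_bracket, h, VF.bracket_skew]
      ext m
      exact neg_eq_zero.2 (by rw [VF.bracket_apply]; simp)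
    have h2 : (d.bracket (GaugeSec.one I F E)) = 0 := by
      refine GaugeSec.ext' ?_ fun u => ?_
      · ext m
        change mlieBracket I _ 0 m = 0
        simp
      · change d.op u - d.op u = 0
        simp
    have e1 := μ.2 _ h1
    have e2 := μ.2 _ h
    simp only [LinearMap.coe_mk, AddHom.coe_mk, e1, e2, h2, map_zero, sub_zero,
      GaugeSec.op_bracket]
    abel⟩

@[simp] theorem pair_lieDeriv (d r : GaugeSec I F E) (μ : JetSec I F E) :
    (lieDeriv d μ).pair r = d.op (μ.pair r) - μ.pair (d.bracket r) := rfl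

@[simp] theorem proj_lieDeriv (d : GaugeSec I F E) (μ : JetSec I F E) :
    (lieDeriv d μ).proj = d.op μ.proj := by
  have h2 : (d.bracket (GaugeSec.one I F E)).anchor = 0 := by
    ext m
    change mlieBracket I _ 0 m = 0
    simp
  change d.op μ.proj - μ.pair _ = _
  rw [pair_vert _ h2]
  simp

end JetSec
end OmniLie
namespace OmniLie

variable {B : Type*} [NormedAddCommGroup B] [NormedSpace ℝ B]
  {H : Type*} [TopologicalSpace H] (I : ModelWithCorners ℝ B H)
  {M : Type*} [TopologicalSpace M] [ChartedSpace H M] [IsManifold I ∞ M]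
  (F : Type*) [NormedAddCommGroup F] [NormedSpace ℝ F]
  (E : M → Type*) [TopologicalSpace (TotalSpace F E)]
  [∀ x, AddCommGroup (E x)] [∀ x, Module ℝ (E x)] [∀ x : M, TopologicalSpace (E x)]
  [FiberBundle F E] [VectorBundle ℝ F E]

/-! ### The omni-Lie algebroid -/

/-- Sections of `𝓔 = 𝔇E ⊕ 𝔍E`. -/
abbrev OmniSec : Type _ := GaugeSec I F E × JetSec I F E

/-- Sections of `𝒯 = TM ⊕ E`. -/
abbrev TSec : Type _ := VF I M × Cₛ^∞⟮I; F, E⟯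

variable {I F E}

/-- The value at `m` of a section of `𝒯`. -/
def TSec.eval (t : TSec I F E) (m : M) : TangentSpace I m × E m := (t.1 m, t.2 m)

namespace OmniSec

/-- The projection `ρ : 𝓔 → 𝔇E`. -/
def rho (X : OmniSec I F E) : GaugeSec I F E := X.1

/-- The map `𝐛 : 𝓔 → 𝒯`, `𝐛(𝔡 + μ) = α(𝔡) + 𝕡(μ)`. -/
def b (X : OmniSec I F E) : TSec I F E := (X.1.anchor, X.2.proj)

/-- The pairing `(𝔡 + μ, 𝔯 + ν)_E = ½(⟨𝔡, ν⟩_E + ⟨𝔯, μ⟩_E)`. -/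
def pairing (X Y : OmniSec I F E) : Cₛ^∞⟮I; F, E⟯ :=
  (1 / 2 : ℝ) • (Y.2.pair X.1 + X.2.pair Y.1)

/-- `X` and `Y` have the same value at the point `m`, as sections of `𝓔`. -/
def AgreeAt (m : M) (X Y : OmniSec I F E) : Prop :=
  X.1.anchor m = Y.1.anchor m ∧ (∀ u : Cₛ^∞⟮I; F, E⟯, X.1.op u m = Y.1.op u m) ∧
    ∀ d : GaugeSec I F E, X.2.pair d m = Y.2.pair d m

variable [FiniteDimensional ℝ B] [T2Space M]

/-- The bracket `{𝔡 + μ, 𝔯 + ν} = [𝔡, 𝔯] + 𝔏_𝔡 ν - 𝔏_𝔯 μ + 𝕕⟨μ, 𝔯⟩_E`. -/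
def dorfman (X Y : OmniSec I F E) : OmniSec I F E :=
  (X.1.bracket Y.1,
    JetSec.lieDeriv X.1 Y.2 - JetSec.lieDeriv Y.1 X.2 + JetSec.jet (X.2.pair Y.1))

theorem b_dorfman (X Y : OmniSec I F E) :
    (X.dorfman Y).b = (X.b.1.bracket Y.b.1,
      X.1.op Y.b.2 - Y.1.op X.b.2 + X.2.pair Y.1) := by
  simp only [b, dorfman, GaugeSec.anchor_bracket, JetSec.proj_add, JetSec.proj_sub,
    JetSec.proj_lieDeriv, JetSec.proj_jet]

theorem b_dorfman_leibniz (X Y Z : OmniSec I F E) :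
    (X.dorfman (Y.dorfman Z)).b = ((X.dorfman Y).dorfman Z).b + (Y.dorfman (X.dorfman Z)).b := by
  simp only [b_dorfman]
  refine Prod.ext (VF.jacobi _ _ _) ?_
  simp only [dorfman, Prod.snd_add, GaugeSec.op_bracket, JetSec.pair_add, JetSec.pair_sub,
    JetSec.pair_lieDeriv, JetSec.pair_jet, map_add, map_sub]
  abel

/-- The normalizer `N_C` of a subbundle `C ⊂ 𝓔` with space of sections `C`. -/
def normalizer (C : Set (OmniSec I F E)) : Set (OmniSec I F E) :=
  {X | ∀ Y ∈ C, X.dorfman Y ∈ C}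

open Classical in
/-- The falling operator `X̄(t) = 𝐛{X, Y}`, for any `Y` with `𝐛 Y = t`. (Such a `Y` always exists;
the value `0` in the other case is a mere formality.) -/
def falling (X : OmniSec I F E) (t : TSec I F E) : TSec I F E :=
  if h : ∃ Y : OmniSec I F E, Y.b = t then (X.dorfman h.choose).b else 0

/-- The falling operator does not depend on the choice of `Y`. -/
theorem falling_b (X Y : OmniSec I F E) : X.falling Y.b = (X.dorfman Y).b := by
  have h : ∃ Z : OmniSec I F E, Z.b = Y.b := ⟨Y, rfl⟩
  rw [falling, dif_pos h]
  obtain ⟨h1, h2⟩ := Prod.ext_iff.1 h.choose_spec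
  generalize h.choose = Z at h1 h2
  have h3 : (Z.1 - Y.1).anchor = 0 := sub_eq_zero.2 h1
  have h4 := X.2.pair_vert h3
  have h5 : X.2.pair (Z.1 - Y.1) = X.2.pair Z.1 - X.2.pair Y.1 := map_sub X.2.1 _ _
  have h6 : (Z.1 - Y.1).op X.2.proj = Z.1.op X.2.proj - Y.1.op X.2.proj := rfl
  rw [h5, h6] at h4
  rw [b_dorfman, b_dorfman, h1, h2]
  refine Prod.ext rfl ?_
  refine sub_eq_zero.1 (Eq.trans ?_ (sub_eq_zero.2 h4))
  simp only [b]
  abel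

end OmniSec

/-! ### Subbundles of `TM ⊕ E` and projective Lie algebroids -/

variable (I F E) in
/-- A smooth vector subbundle `A ⊂ TM ⊕ E`: subspaces of the fibres which are locally spanned by
pointwise linearly independent smooth sections (extended to `M` by a cut-off). -/
structure Subbundle where
  /-- The fibre at `m`. -/
  fibre : ∀ m : M, Submodule ℝ (TangentSpace I m × E m)
  exists_frame : ∀ m₀ : M, ∃ (k : ℕ) (a : Fin k → TSec I F E), (∀ i m, (a i).eval m ∈ fibre m) ∧
    ∀ᶠ m in 𝓝 m₀, LinearIndependent ℝ (fun i => (a i).eval m) ∧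
      Submodule.span ℝ (Set.range fun i => (a i).eval m) = fibre m

namespace Subbundle

/-- The `C^∞(M)`-module `Γ(A)`. -/
def sections (A : Subbundle I F E) : Submodule C^∞⟮I, M; ℝ⟯ (TSec I F E) where
  carrier := {t | ∀ m, t.eval m ∈ A.fibre m}
  zero_mem' m := (A.fibre m).zero_mem
  add_mem' ha hb m := (A.fibre m).add_mem (ha m) (hb m)
  smul_mem' f _ ha m := (A.fibre m).smul_mem (f m) (ha m)

/-- `Γ(𝐛⁻¹(A))`. -/
def preimage (A : Subbundle I F E) : Set (OmniSec I F E) := {X | X.b ∈ A.sections}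

end Subbundle

variable (I F E) in
/-- A section of `Hom(𝒯, E)`, i.e. a smooth bundle map `TM ⊕ E → E`. -/
structure HomTE where
  /-- The linear map on the fibre at `m`. -/
  toFun : ∀ m : M, TangentSpace I m × E m →ₗ[ℝ] E m
  smooth : ∀ t : TSec I F E, ContMDiff I (I.prod 𝓘(ℝ, F)) ∞
    fun m => TotalSpace.mk' F m (toFun m (t.eval m))

namespace HomTE

/-- A bundle map applied to a section. -/
def apply (h : HomTE I F E) (t : TSec I F E) : Cₛ^∞⟮I; F, E⟯ :=
  ⟨fun m => h.toFun m (t.eval m), h.smooth t⟩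

theorem apply_add (h : HomTE I F E) (s t : TSec I F E) :
    h.apply (s + t) = h.apply s + h.apply t := by
  ext m; exact map_add (h.toFun m) (TSec.eval s m) (TSec.eval t m)

theorem apply_smul (h : HomTE I F E) (f : C^∞⟮I, M; ℝ⟯) (t : TSec I F E) :
    h.apply (f • t) = f • h.apply t := by
  ext m; exact map_smul (h.toFun m) (f m) (TSec.eval t m)

theorem apply_const_smul (h : HomTE I F E) (r : ℝ) (t : TSec I F E) :
    h.apply (r • t) = r • h.apply t := by
  ext m; exact map_smul (h.toFun m) r (TSec.eval t m)

/-- The embedding `𝐚 : Hom(𝒯, E) → 𝓔`: `Φ + 𝔶` with `Φ ∈ gl(E)`, `𝔶 ∈ Hom(TM, E)` is sent to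
`𝕚(Φ) + 𝕖(𝔶)`, where `⟨𝕖(𝔶), 𝔡⟩_E = 𝔶(α(𝔡))`. -/
def a (h : HomTE I F E) : OmniSec I F E :=
  (⟨(0, { toFun := fun u => h.apply (0, u)
          map_add' := fun u v => by rw [← apply_add]; simp
          map_smul' := fun r u => by
            rw [RingHom.id_apply, ← apply_const_smul]; simp }), fun f u => by
      change h.apply (0, f • u) = f • h.apply (0, u) + (0 : VF I M).deriv f • u
      rw [← apply_smul, VF.zero_deriv, zero_smul, add_zero]
      simp⟩,
   ⟨{ toFun := fun d => h.apply (d.anchor, 0)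
      map_add' := fun d r => by rw [← apply_add]; simp
      map_smul' := fun f d => by rw [RingHom.id_apply, ← apply_smul]; simp }, fun Φ hΦ => by
      have h0 : h.apply (0, 0) = 0 := by
        ext m; exact map_zero (h.toFun m)
      simp only [LinearMap.coe_mk, AddHom.coe_mk, hΦ, GaugeSec.anchor_one, h0, map_zero]⟩)

end HomTE

/-- `Γ(A⁰)`, where `A⁰ = {h ∈ Hom(𝒯, E) | h(A) = 0}` is regarded as a subbundle of `𝓔`. -/
def Subbundle.annihilator (A : Subbundle I F E) : Set (OmniSec I F E) :=
  {X | ∃ h : HomTE I F E, (∀ m, ∀ v ∈ A.fibre m, h.toFun m v = 0) ∧ h.a = X}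

variable [FiniteDimensional ℝ B]

/-- A bracket on `Γ(A)` which makes `A` a Lie algebroid with anchor the projection to `TM`. -/
structure Subbundle.IsLieAlgebroidBracket (A : Subbundle I F E)
    (br : A.sections → A.sections → A.sections) : Prop where
  add_right : ∀ a b c, br a (b + c) = br a b + br a c
  smul_right : ∀ (r : ℝ) (a b), br a (r • b) = r • br a b
  skew : ∀ a b, br a b = - br b a
  jacobi : ∀ a b c, br (br a b) c + br (br b c) a + br (br c a) b = 0
  leibniz : ∀ (a : A.sections) (f : C^∞⟮I, M; ℝ⟯) (b : A.sections),
    br a (f • b) = f • br a b + a.1.1.deriv f • b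
  anchor : ∀ a b, (br a b).1.1 = a.1.1.bracket b.1.1

variable (I F E) in
/-- A projective Lie algebroid in `TM ⊕ E`. -/
structure ProjLieAlgebroid extends Subbundle I F E where
  /-- The bracket `[·,·]_A` on `Γ(A)`. -/
  bracket : toSubbundle.sections → toSubbundle.sections → toSubbundle.sections
  isLie : toSubbundle.IsLieAlgebroidBracket bracket

end OmniLie
namespace OmniLie

variable {B : Type*} [NormedAddCommGroup B] [NormedSpace ℝ B] [FiniteDimensional ℝ B]
  {H : Type*} [TopologicalSpace H] {I : ModelWithCorners ℝ B H}
  {M : Type*} [TopologicalSpace M] [ChartedSpace H M] [IsManifold I ∞ M] [T2Space M]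
  {F : Type*} [NormedAddCommGroup F] [NormedSpace ℝ F]
  {E : M → Type*} [TopologicalSpace (TotalSpace F E)]
  [∀ x, AddCommGroup (E x)] [∀ x, Module ℝ (E x)] [∀ x : M, TopologicalSpace (E x)]
  [FiberBundle F E] [VectorBundle ℝ F E]

/-! ### The lifted Dirac structure -/

/-- `X ∈ Γ(L^A)`: at every point `m`, the value `X_m` lies in `𝐛⁻¹(A)_m` and has an extension
`X̃ ∈ Γ(𝐛⁻¹(A))` with `𝐛{X̃, Y}_m = ([𝐛X̃, 𝐛Y]_A)_m` for all `Y ∈ Γ(𝐛⁻¹(A))`. -/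
def ProjLieAlgebroid.lift (A : ProjLieAlgebroid I F E) : Set (OmniSec I F E) :=
  {X | ∀ m, X.b.eval m ∈ A.fibre m ∧
    ∃ (X' : OmniSec I F E) (hX' : X' ∈ A.preimage), X'.AgreeAt m X ∧
      ∀ (Y : OmniSec I F E) (hY : Y ∈ A.preimage),
        (X'.dorfman Y).b.eval m = (A.bracket ⟨X'.b, hX'⟩ ⟨Y.b, hY⟩).1.eval m}

theorem ProjLieAlgebroid.lift_subset (A : ProjLieAlgebroid I F E) : A.lift ⊆ A.preimage :=
  fun _ hX m => (hX m).1

section Tensorial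

variable [FiniteDimensional ℝ F] [ContMDiffVectorBundle ∞ F E I]

/-- Sections of `TM ⊕ E` which are linearly independent at `m₀` admit a smooth dual family of
covectors at `m₀`. -/
theorem exists_covectors {m₀ : M} {k : ℕ} (a : Fin k → TSec I F E)
    (ha : LinearIndependent ℝ fun i => (a i).eval m₀) :
    ∃ l : Fin k → ∀ m : M, TangentSpace I m × E m →ₗ[ℝ] ℝ,
      (∀ j (t : TSec I F E), ContMDiff I 𝓘(ℝ, ℝ) ∞ fun m => l j m (t.eval m)) ∧
      ∀ i j, l j m₀ ((a i).eval m₀) = if i = j then 1 else 0 := by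
  classical
  let e₁ := trivializationAt B (TangentSpace I : M → Type _) m₀
  let e₂ := trivializationAt F E m₀
  have h₁ : m₀ ∈ e₁.baseSet := FiberBundle.mem_baseSet_trivializationAt' m₀
  have h₂ : m₀ ∈ e₂.baseSet := FiberBundle.mem_baseSet_trivializationAt' m₀
  let w : ∀ m : M, TangentSpace I m × E m →ₗ[ℝ] B × F := fun m =>
    (e₁.linearMapAt ℝ m).prodMap (e₂.linearMapAt ℝ m)
  have hw : LinearMap.ker (w m₀) = ⊥ := by
    refine LinearMap.ker_eq_bot'.2 fun v hv => ?_
    have hv1 : e₁.linearMapAt ℝ m₀ v.1 = 0 := congrArg Prod.fst hv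
    have hv2 : e₂.linearMapAt ℝ m₀ v.2 = 0 := congrArg Prod.snd hv
    rw [e₁.linearMapAt_def_of_mem h₁] at hv1
    rw [e₂.linearMapAt_def_of_mem h₂] at hv2
    exact Prod.ext ((e₁.linearEquivAt ℝ m₀ h₁).map_eq_zero_iff.1 hv1)
      ((e₂.linearEquivAt ℝ m₀ h₂).map_eq_zero_iff.1 hv2)
  have hli := ha.map' (w m₀) hw
  obtain ⟨g, hg⟩ := LinearMap.exists_extend (hli.repr : _ →ₗ[ℝ] _)
  have hgi (i : Fin k) : g (w m₀ ((a i).eval m₀)) = Finsupp.single i 1 := by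
    have := LinearMap.congr_fun hg ⟨_, Submodule.subset_span ⟨i, rfl⟩⟩
    refine Eq.trans this ?_
    exact hli.repr_eq_single i _ rfl
  obtain ⟨ψ, hψ1, hψs⟩ := exists_cutoff (I := I)
    ((e₁.open_baseSet.inter e₂.open_baseSet).mem_nhds ⟨h₁, h₂⟩)
  refine ⟨fun j m => ψ m • (Finsupp.lapply j ∘ₗ g ∘ₗ w m), fun j t => ?_, fun i j => ?_⟩
  · refine contMDiff_of_tsupport fun m hm => ?_
    have hsub : (Function.support fun m => (ψ m • (Finsupp.lapply j ∘ₗ g ∘ₗ w m)) (t.eval m)) ⊆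
        Function.support ψ := fun x hx h0 => hx (by
      change ψ x * _ = 0
      rw [h0, zero_mul])
    have hm' : m ∈ e₁.baseSet ∩ e₂.baseSet := hψs (closure_mono hsub hm)
    have c₁ : ContMDiffAt I 𝓘(ℝ, B) ∞ (fun x => (e₁ ⟨x, t.1 x⟩).2) m :=
      (e₁.contMDiffAt_section_iff hm'.1).1 (t.1.contMDiff m)
    have c₂ : ContMDiffAt I 𝓘(ℝ, F) ∞ (fun x => (e₂ ⟨x, t.2 x⟩).2) m :=
      (e₂.contMDiffAt_section_iff hm'.2).1 (t.2.contMDiff m)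
    have c₃ := (LinearMap.toContinuousLinearMap (Finsupp.lapply j ∘ₗ g)).contMDiff.contMDiffAt
      |>.comp m (c₁.prodMk_space c₂)
    have c₄ := (ψ.contMDiff m).mul c₃
    refine c₄.congr_of_eventuallyEq ?_
    filter_upwards [(e₁.open_baseSet.inter e₂.open_baseSet).mem_nhds hm'] with x hx
    have r₁ : e₁.linearMapAt ℝ x (t.1 x) = (e₁ ⟨x, t.1 x⟩).2 := by
      rw [e₁.coe_linearMapAt_of_mem hx.1]
    have r₂ : e₂.linearMapAt ℝ x (t.2 x) = (e₂ ⟨x, t.2 x⟩).2 := by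
      rw [e₂.coe_linearMapAt_of_mem hx.2]
    change ψ x * (g (e₁.linearMapAt ℝ x (t.1 x), e₂.linearMapAt ℝ x (t.2 x))) j = _
    rw [r₁, r₂]
    rfl
  · change ψ m₀ * (g (w m₀ ((a i).eval m₀))) j = _
    rw [hgi, hψ1, one_mul, Finsupp.single_apply]

/-- A section of a subbundle that vanishes at `m₀` is, up to a function equal to `1` at `m₀`,
a combination of sections with coefficients that vanish at `m₀`. -/
theorem Subbundle.exists_combination (A : Subbundle I F E) (m₀ : M) (t : A.sections)
    (ht : t.1.eval m₀ = 0) :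
    ∃ (g : C^∞⟮I, M; ℝ⟯) (k : ℕ) (f : Fin k → C^∞⟮I, M; ℝ⟯) (s : Fin k → A.sections),
      g m₀ = 1 ∧ (∀ i, f i m₀ = 0) ∧ g • t = ∑ i, f i • s i := by
  classical
  obtain ⟨k, a, haA, hU⟩ := A.exists_frame m₀
  obtain ⟨l, hl, hl0⟩ := exists_covectors a hU.self_of_nhds.1
  let c (j : Fin k) (t : TSec I F E) : C^∞⟮I, M; ℝ⟯ := ⟨fun m => l j m (t.eval m), hl j t⟩
  let G : Matrix (Fin k) (Fin k) C^∞⟮I, M; ℝ⟯ := Matrix.of fun j i => c j (a i)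
  let bv : Fin k → C^∞⟮I, M; ℝ⟯ := fun j => c j t.1
  have hG : G.det m₀ = 1 := by
    have h1 : (ContMDiffMap.evalRingHom m₀ : C^∞⟮I, M; ℝ⟯ →+* ℝ) G.det =
      ((ContMDiffMap.evalRingHom m₀ : C^∞⟮I, M; ℝ⟯ →+* ℝ).mapMatrix G).det := RingHom.map_det _ _
    have h2 : (ContMDiffMap.evalRingHom m₀ : C^∞⟮I, M; ℝ⟯ →+* ℝ).mapMatrix G = 1 := by
      ext j i
      refine (hl0 i j).trans ?_
      simp [Matrix.one_apply, eq_comm]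
    rw [h2, Matrix.det_one] at h1
    exact h1
  obtain ⟨χ, hχ1, hχs⟩ := exists_cutoff (I := I) hU
  have ev_sum {ι : Type} (S : Finset ι) (f : ι → C^∞⟮I, M; ℝ⟯) (m : M) :
      (∑ i ∈ S, f i) m = ∑ i ∈ S, f i m :=
    map_sum (ContMDiffMap.evalRingHom m : C^∞⟮I, M; ℝ⟯ →+* ℝ) f S
  refine ⟨χ * G.det, k, fun i => χ * (G.adjugate.mulVec bv) i, fun i => ⟨a i, haA i⟩, ?_, ?_, ?_⟩
  · change χ m₀ * G.det m₀ = 1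
    rw [hG, hχ1, one_mul]
  · intro i
    change χ m₀ * (∑ j, G.adjugate i j * bv j) m₀ = 0
    rw [ev_sum]
    refine mul_eq_zero_of_right _ (Finset.sum_eq_zero fun j _ => ?_)
    change G.adjugate i j m₀ * l j m₀ (t.1.eval m₀) = 0
    rw [ht, map_zero, mul_zero]
  · have key (m : M) : ((χ * G.det) m) • t.1.eval m =
        ∑ i, ((χ * (G.adjugate.mulVec bv) i : C^∞⟮I, M; ℝ⟯) m) • (a i).eval m := by
      by_cases hm : χ m = 0
      · have h0 (f : C^∞⟮I, M; ℝ⟯) : (χ * f) m = 0 := by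
          change χ m * f m = 0
          rw [hm, zero_mul]
        simp [h0]
      · have hmU := hχs (subset_tsupport _ hm)
        have hsp : t.1.eval m ∈ Submodule.span ℝ (Set.range fun i => (a i).eval m) := by
          rw [hmU.2]; exact t.2 m
        obtain ⟨γ, hγ⟩ := (Submodule.mem_span_range_iff_exists_fun ℝ).1 hsp
        have hb (j : Fin k) : bv j m = ∑ i, G j i m * γ i := by
          change l j m (t.1.eval m) = _
          rw [← hγ, map_sum]
          refine Finset.sum_congr rfl fun i _ => ?_
          rw [map_smul, smul_eq_mul, mul_comm]
          rfl
        have hadj (i : Fin k) : (G.adjugate.mulVec bv) i m = G.det m * γ i := by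
          change (∑ j, G.adjugate i j * bv j) m = _
          rw [ev_sum]
          have h1 (i' : Fin k) : ∑ j, G.adjugate i j m * G j i' m = if i = i' then G.det m else 0 := by
            have h2 := congrFun (congrFun (Matrix.adjugate_mul G) i) i'
            have h3 := congrArg (fun f : C^∞⟮I, M; ℝ⟯ => f m) h2
            rw [Matrix.mul_apply] at h3
            refine ((ev_sum _ _ m).symm.trans h3).trans ?_
            by_cases hii : i = i' <;> simp [hii, Matrix.smul_apply]
          calc ∑ j, (G.adjugate i j * bv j) m
              = ∑ j, ∑ i', G.adjugate i j m * G j i' m * γ i' := by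
                refine Finset.sum_congr rfl fun j _ => ?_
                change G.adjugate i j m * bv j m = _
                rw [hb, Finset.mul_sum]
                exact Finset.sum_congr rfl fun i' _ => (mul_assoc _ _ _).symm
            _ = ∑ i', (∑ j, G.adjugate i j m * G j i' m) * γ i' := by
                rw [Finset.sum_comm]
                exact Finset.sum_congr rfl fun i' _ => (Finset.sum_mul _ _ _).symm
            _ = G.det m * γ i := by simp [h1]
        rw [← hγ, Finset.smul_sum]
        refine Finset.sum_congr rfl fun i _ => ?_
        change (χ m * G.det m) • γ i • (a i).eval m = (χ m * (G.adjugate.mulVec bv) i m) • _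
        rw [hadj, smul_smul, mul_assoc]
    let ev (m : M) : A.sections →+ TangentSpace I m × E m :=
      { toFun := fun s => s.1.eval m
        map_zero' := rfl
        map_add' := fun _ _ => rfl }
    have hev (m : M) : ev m ((χ * G.det) • t) =
        ev m (∑ i, (χ * (G.adjugate.mulVec bv) i) • (⟨a i, haA i⟩ : A.sections)) := by
      rw [map_sum]; exact key m
    refine Subtype.ext (Prod.ext ?_ ?_)
    · ext m; exact congrArg Prod.fst (hev m)
    · ext m; exact congrArg Prod.snd (hev m)

/-- An additive operator on `Γ(A)` that is linear over functions depends only on values. -/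
theorem Subbundle.eval_eq_zero (A : Subbundle I F E) (Q : A.sections →+ TSec I F E)
    (hQ : ∀ (f : C^∞⟮I, M; ℝ⟯) t, Q (f • t) = f • Q t) (m₀ : M) (t : A.sections)
    (ht : t.1.eval m₀ = 0) : (Q t).eval m₀ = 0 := by
  obtain ⟨g, k, f, s, hg, hf, h⟩ := A.exists_combination m₀ t ht
  let ev : TSec I F E →+ TangentSpace I m₀ × E m₀ :=
    { toFun := fun s => s.eval m₀
      map_zero' := rfl
      map_add' := fun _ _ => rfl }
  have h1 : ev (Q (g • t)) = ev (Q (∑ i, f i • s i)) := by rw [h]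
  rw [map_sum, map_sum, hQ] at h1
  have h2 : ev (g • Q t) = g m₀ • (Q t).eval m₀ := rfl
  rw [h2, hg, one_smul] at h1
  rw [h1]
  refine Finset.sum_eq_zero fun i _ => ?_
  rw [hQ]
  change f i m₀ • (Q (s i)).eval m₀ = 0
  rw [hf, zero_smul]

/-- The condition defining `L^A` does not depend on the chosen extension. -/
theorem ProjLieAlgebroid.mem_lift_iff (A : ProjLieAlgebroid I F E) (X : OmniSec I F E) :
    X ∈ A.lift ↔ ∃ hX : X ∈ A.preimage, ∀ (Y : OmniSec I F E) (hY : Y ∈ A.preimage),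
      (X.dorfman Y).b = (A.bracket ⟨X.b, hX⟩ ⟨Y.b, hY⟩).1 := by
  constructor
  · refine fun h => ⟨A.lift_subset h, fun Y hY => ?_⟩
    have hX := A.lift_subset h
    suffices hm : ∀ m, (X.dorfman Y).b.eval m = (A.bracket ⟨X.b, hX⟩ ⟨Y.b, hY⟩).1.eval m from
      Prod.ext (by ext m; exact congrArg Prod.fst (hm m)) (by ext m; exact congrArg Prod.snd (hm m))
    intro m
    obtain ⟨-, X', hX', ⟨h1, h2, h3⟩, h4⟩ := h m
    let yb : A.sections := ⟨Y.b, hY⟩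
    let Q : A.sections →+ TSec I F E :=
      { toFun := fun t => (A.bracket yb t).1 - (Y.b.1.bracket t.1.1, Y.1.op t.1.2)
        map_zero' := by
          have e1 : A.bracket yb 0 = 0 := by simpa using A.isLie.smul_right 0 yb 0
          have e2 : Y.b.1.bracket 0 = 0 := by
            simpa using VF.bracket_smul Y.b.1 0 0
          change (A.bracket yb 0).1 - (Y.b.1.bracket 0, Y.1.op 0) = 0
          rw [e1, e2, map_zero]
          exact sub_zero 0
        map_add' := fun s t => by
          have e1 := A.isLie.add_right yb s t
          refine Prod.ext ?_ ?_
          · have e2 := VF.bracket_add Y.b.1 s.1.1 t.1.1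
            change (A.bracket yb (s + t)).1.1 - Y.b.1.bracket (s.1.1 + t.1.1) =
              ((A.bracket yb s).1.1 - Y.b.1.bracket s.1.1) +
              ((A.bracket yb t).1.1 - Y.b.1.bracket t.1.1)
            rw [e1, e2]
            exact add_sub_add_comm _ _ _ _
          · change (A.bracket yb (s + t)).1.2 - Y.1.op (s.1.2 + t.1.2) =
              ((A.bracket yb s).1.2 - Y.1.op s.1.2) + ((A.bracket yb t).1.2 - Y.1.op t.1.2)
            rw [e1, map_add]
            exact add_sub_add_comm _ _ _ _ }
    have hQ (f : C^∞⟮I, M; ℝ⟯) (t : A.sections) : Q (f • t) = f • Q t := by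
      have e1 := A.isLie.leibniz yb f t
      refine Prod.ext ?_ ?_
      · change (A.bracket yb (f • t)).1.1 - Y.b.1.bracket (f • t.1.1) =
          f • ((A.bracket yb t).1.1 - Y.b.1.bracket t.1.1)
        rw [e1, VF.bracket_smul, smul_sub]
        exact add_sub_add_right_eq_sub _ _ _
      · change (A.bracket yb (f • t)).1.2 - Y.1.op (f • t.1.2) =
          f • ((A.bracket yb t).1.2 - Y.1.op t.1.2)
        rw [e1, GaugeSec.op_smul, smul_sub]
        exact add_sub_add_right_eq_sub _ _ _
    have hb : X'.b.eval m = X.b.eval m := Prod.ext h1 (h3 _)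
    let s : A.sections := ⟨X'.b, hX'⟩ - ⟨X.b, hX⟩
    have hs : s.1.eval m = 0 := sub_eq_zero.2 hb
    have h0 := A.eval_eq_zero Q hQ m s hs
    have hQs : Q s = Q ⟨X'.b, hX'⟩ - Q ⟨X.b, hX⟩ := map_sub Q _ _
    have h5 : (Q ⟨X'.b, hX'⟩).eval m = (Q ⟨X.b, hX⟩).eval m := by
      rw [hQs] at h0
      exact sub_eq_zero.1 h0
    have hD (Z : OmniSec I F E) (hZ : Z ∈ A.preimage) :
        (Z.dorfman Y).b - (A.bracket ⟨Z.b, hZ⟩ yb).1 =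
          Q ⟨Z.b, hZ⟩ + ((0, Z.1.op Y.b.2 + Z.2.pair Y.1) : TSec I F E) := by
      rw [OmniSec.b_dorfman, A.isLie.skew, VF.bracket_skew]
      refine Prod.ext ?_ ?_
      · change -(Y.b.1.bracket Z.b.1) - -(A.bracket yb ⟨Z.b, hZ⟩).1.1 =
          ((A.bracket yb ⟨Z.b, hZ⟩).1.1 - Y.b.1.bracket Z.b.1) + 0
        abel
      · change (Z.1.op Y.b.2 - Y.1.op Z.b.2 + Z.2.pair Y.1) - -(A.bracket yb ⟨Z.b, hZ⟩).1.2 =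
          ((A.bracket yb ⟨Z.b, hZ⟩).1.2 - Y.1.op Z.b.2) + (Z.1.op Y.b.2 + Z.2.pair Y.1)
        abel
    have hR : TSec.eval (0, X'.1.op Y.b.2 + X'.2.pair Y.1) m =
        TSec.eval (0, X.1.op Y.b.2 + X.2.pair Y.1) m :=
      Prod.ext rfl (congrArg₂ (· + ·) (h2 _) (h3 _))
    have e1 := congrArg (fun t : TSec I F E => t.eval m) (hD X' hX')
    have e2 := congrArg (fun t : TSec I F E => t.eval m) (hD X hX)
    have e3 : (X.dorfman Y).b.eval m - (A.bracket ⟨X.b, hX⟩ yb).1.eval m =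
        (X'.dorfman Y).b.eval m - (A.bracket ⟨X'.b, hX'⟩ yb).1.eval m :=
      e2.trans ((congrArg₂ (· + ·) h5 hR).symm.trans e1.symm)
    rw [h4 Y hY, sub_self] at e3
    exact sub_eq_zero.1 e3
  · rintro ⟨hX, h⟩ m
    exact ⟨hX m, X, hX, ⟨rfl, fun _ => rfl, fun _ => rfl⟩, fun Y hY => by rw [h Y hY]⟩

end Tensorial

end OmniLie
namespace OmniLie

variable {B : Type*} [NormedAddCommGroup B] [NormedSpace ℝ B] [FiniteDimensional ℝ B]
  {H : Type*} [TopologicalSpace H] {I : ModelWithCorners ℝ B H}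
  {M : Type*} [TopologicalSpace M] [ChartedSpace H M] [IsManifold I ∞ M] [T2Space M]
  {F : Type*} [NormedAddCommGroup F] [NormedSpace ℝ F]
  {E : M → Type*} [TopologicalSpace (TotalSpace F E)]
  [∀ x, AddCommGroup (E x)] [∀ x, Module ℝ (E x)] [∀ x : M, TopologicalSpace (E x)]
  [FiberBundle F E] [VectorBundle ℝ F E]

section Coboundary

variable [FiniteDimensional ℝ F] [ContMDiffVectorBundle ∞ F E I]

/-- `Γ(L^A)` is closed under the bracket. -/
theorem ProjLieAlgebroid.dorfman_mem_lift (A : ProjLieAlgebroid I F E) {X₁ X₂ : OmniSec I F E}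
    (h₁ : X₁ ∈ A.lift) (h₂ : X₂ ∈ A.lift) : X₁.dorfman X₂ ∈ A.lift := by
  obtain ⟨p₁, q₁⟩ := (A.mem_lift_iff X₁).1 h₁
  obtain ⟨p₂, q₂⟩ := (A.mem_lift_iff X₂).1 h₂
  have hmem {X Y : OmniSec I F E} (hX : X ∈ A.lift) (hY : Y ∈ A.preimage) :
      X.dorfman Y ∈ A.preimage := by
    obtain ⟨p, q⟩ := (A.mem_lift_iff X).1 hX
    change (X.dorfman Y).b ∈ A.sections
    rw [q Y hY]
    exact Subtype.property _
  refine (A.mem_lift_iff _).2 ⟨hmem h₁ p₂, fun Y hY => ?_⟩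
  have r₁ : (⟨(X₁.dorfman Y).b, hmem h₁ hY⟩ : A.sections) = A.bracket ⟨X₁.b, p₁⟩ ⟨Y.b, hY⟩ :=
    Subtype.ext (q₁ Y hY)
  have r₂ : (⟨(X₂.dorfman Y).b, hmem h₂ hY⟩ : A.sections) = A.bracket ⟨X₂.b, p₂⟩ ⟨Y.b, hY⟩ :=
    Subtype.ext (q₂ Y hY)
  have r₃ : (⟨(X₁.dorfman X₂).b, hmem h₁ p₂⟩ : A.sections) =
      A.bracket ⟨X₁.b, p₁⟩ ⟨X₂.b, p₂⟩ := Subtype.ext (q₁ X₂ p₂)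
  have key := OmniSec.b_dorfman_leibniz X₁ X₂ Y
  rw [q₁ _ (hmem h₂ hY), q₂ _ (hmem h₁ hY), r₁, r₂] at key
  rw [r₃]
  have jac := A.isLie.jacobi ⟨X₁.b, p₁⟩ ⟨X₂.b, p₂⟩ ⟨Y.b, hY⟩
  have s₁ := A.isLie.skew (A.bracket ⟨X₂.b, p₂⟩ ⟨Y.b, hY⟩) ⟨X₁.b, p₁⟩
  have s₂ : A.bracket (A.bracket ⟨Y.b, hY⟩ ⟨X₁.b, p₁⟩) ⟨X₂.b, p₂⟩ =
      A.bracket ⟨X₂.b, p₂⟩ (A.bracket ⟨X₁.b, p₁⟩ ⟨Y.b, hY⟩) := by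
    have e (u v : A.sections) : A.bracket u (-v) = - A.bracket u v := by
      have z0 := A.isLie.add_right u 0 0
      rw [add_zero] at z0
      have z1 := A.isLie.add_right u (-v) v
      rw [neg_add_cancel, left_eq_add.1 z0] at z1
      exact eq_neg_of_add_eq_zero_left z1.symm
    rw [A.isLie.skew _ ⟨X₂.b, p₂⟩, A.isLie.skew ⟨Y.b, hY⟩ ⟨X₁.b, p₁⟩, e, neg_neg]
  rw [s₁, s₂] at jac
  have jac' := congrArg Subtype.val jac
  simp only [Submodule.coe_add, Submodule.coe_neg, Submodule.coe_zero] at jac'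
  refine (eq_sub_of_add_eq key.symm).trans ?_
  refine (eq_sub_of_add_eq ?_).symm
  refine (sub_eq_zero.1 (Eq.trans ?_ jac'))
  abel

/-- `Γ(L^A)` as a type. -/
abbrev ProjLieAlgebroid.LiftSec (A : ProjLieAlgebroid I F E) : Type _ := A.lift

/-- The bracket of `Γ(L^A)`. -/
def ProjLieAlgebroid.liftBracket (A : ProjLieAlgebroid I F E) (l₁ l₂ : A.LiftSec) : A.LiftSec :=
  ⟨l₁.1.dorfman l₂.1, A.dorfman_mem_lift l₁.2 l₂.2⟩

/-- The coboundary `d_{L^A} φ` of a 1-cochain `φ` of the Lie algebroid `L^A` with coefficients in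
the representation `ρ|_{L^A} : L^A → 𝔇E`. -/
def ProjLieAlgebroid.dLift (A : ProjLieAlgebroid I F E) (φ : A.LiftSec → Cₛ^∞⟮I; F, E⟯)
    (l₁ l₂ : A.LiftSec) : Cₛ^∞⟮I; F, E⟯ :=
  l₁.1.rho.op (φ l₂) - l₂.1.rho.op (φ l₁) - φ (A.liftBracket l₁ l₂)

/-- The 1-cochain `ω_X = (X, ·)_E` of `L^A`. -/
def ProjLieAlgebroid.omega (A : ProjLieAlgebroid I F E) (X : OmniSec I F E) (l : A.LiftSec) :
    Cₛ^∞⟮I; F, E⟯ := X.pairing l.1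

end Coboundary

/-! ### Deformations -/

/-- A smooth bundle map `Ω : A ∧ A → A ∩ E`, where `(A ∩ E)_m = {u ∈ E_m | (0, u) ∈ A_m}`. -/
structure Subbundle.TwoForm (A : Subbundle I F E) where
  /-- The bilinear map on the fibre at `m`. -/
  toFun : ∀ m : M, A.fibre m →ₗ[ℝ] A.fibre m →ₗ[ℝ] E m
  alt : ∀ m v, toFun m v v = 0
  mem : ∀ m v w, ((0, toFun m v w) : TangentSpace I m × E m) ∈ A.fibre m
  smooth : ∀ a b : A.sections, ContMDiff I (I.prod 𝓘(ℝ, F)) ∞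
    fun m => TotalSpace.mk' F m (toFun m ⟨a.1.eval m, a.2 m⟩ ⟨b.1.eval m, b.2 m⟩)

namespace Subbundle.TwoForm

variable {A : Subbundle I F E}

/-- `Ω(a, b)` as a section of `E`. -/
def applyE (Ω : A.TwoForm) (a b : A.sections) : Cₛ^∞⟮I; F, E⟯ :=
  ⟨fun m => Ω.toFun m ⟨a.1.eval m, a.2 m⟩ ⟨b.1.eval m, b.2 m⟩, Ω.smooth a b⟩

/-- `Ω(a, b)` as a section of `A`. -/
def apply (Ω : A.TwoForm) (a b : A.sections) : A.sections :=
  ⟨(0, Ω.applyE a b), fun m => Ω.mem m _ _⟩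

end Subbundle.TwoForm

namespace ProjLieAlgebroid

variable (A : ProjLieAlgebroid I F E)

/-- `Ω` generates a deformation of `A`: every bracket `[·,·]_A + ε Ω` makes `A` a projective Lie
algebroid. -/
def GeneratesDeformation (Ω : A.TwoForm) : Prop :=
  ∀ ε : ℝ, A.IsLieAlgebroidBracket fun a b => A.bracket a b + ε • Ω.apply a b

/-- `(𝐛*Ω)(l₁, l₂) = Ω(𝐛 l₁, 𝐛 l₂)`. -/
def pullback (Ω : A.TwoForm) (l₁ l₂ : A.LiftSec) : Cₛ^∞⟮I; F, E⟯ :=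
  Ω.applyE ⟨l₁.1.b, A.lift_subset l₁.2⟩ ⟨l₂.1.b, A.lift_subset l₂.2⟩

/-- For `X ∈ N_{𝐛⁻¹(A)}` the falling `X̄` restricts to `Γ(A)`. -/
def fallingOn {X : OmniSec I F E} (hX : X ∈ OmniSec.normalizer A.preimage) (a : A.sections) :
    A.sections :=
  ⟨X.falling a.1, by
    by_cases h : ∃ Y : OmniSec I F E, Y.b = a.1
    · obtain ⟨Y, hY⟩ := h
      rw [← hY, OmniSec.falling_b]
      refine hX Y ?_
      change Y.b ∈ A.sections
      rw [hY]
      exact a.2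
    · rw [OmniSec.falling, dif_neg h]
      exact A.sections.zero_mem⟩

/-- `[X̄a, b]_A + [a, X̄b]_A - X̄[a, b]_A`. -/
def twist {X : OmniSec I F E} (hX : X ∈ OmniSec.normalizer A.preimage) (a b : A.sections) :
    A.sections :=
  A.bracket (A.fallingOn hX a) b + A.bracket a (A.fallingOn hX b) - A.fallingOn hX (A.bracket a b)

/-- The torsion `T^X(a, b) = X̄([X̄a, b]_A + [a, X̄b]_A - X̄[a, b]_A) - [X̄a, X̄b]_A`. -/
def torsion {X : OmniSec I F E} (hX : X ∈ OmniSec.normalizer A.preimage) (a b : A.sections) :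
    A.sections :=
  A.fallingOn hX (A.twist hX a b) - A.bracket (A.fallingOn hX a) (A.fallingOn hX b)

/-- The condition `[T^X(a, b), c]_A + T^X([a, b]_A, c) + c.p. = 0`. -/
def TorsionCyclic {X : OmniSec I F E} (hX : X ∈ OmniSec.normalizer A.preimage) : Prop :=
  ∀ a b c : A.sections,
    (A.bracket (A.torsion hX a b) c + A.torsion hX (A.bracket a b) c) +
    (A.bracket (A.torsion hX b c) a + A.torsion hX (A.bracket b c) a) +
    (A.bracket (A.torsion hX c a) b + A.torsion hX (A.bracket c a) b) = 0

end ProjLieAlgebroid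

end OmniLie

end

noncomputable section

set_option linter.unusedSectionVars false

namespace OmniLie

/-! ### Local coordinates, tensoriality and gluing -/

section LocalTools

variable {B : Type*} [NormedAddCommGroup B] [NormedSpace ℝ B] [FiniteDimensional ℝ B]
  {H : Type*} [TopologicalSpace H] {I : ModelWithCorners ℝ B H}
  {M : Type*} [TopologicalSpace M] [ChartedSpace H M] [IsManifold I ∞ M] [T2Space M]
  {F : Type*} [NormedAddCommGroup F] [NormedSpace ℝ F]
  {V : M → Type*} [TopologicalSpace (TotalSpace F V)]
  [∀ x, AddCommGroup (V x)] [∀ x, Module ℝ (V x)] [∀ x : M, TopologicalSpace (V x)]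
  [FiberBundle F V] [VectorBundle ℝ F V]
  {F' : Type*} [NormedAddCommGroup F'] [NormedSpace ℝ F']
  {W : M → Type*} [TopologicalSpace (TotalSpace F' W)]
  [∀ x, AddCommGroup (W x)] [∀ x, Module ℝ (W x)] [∀ x : M, TopologicalSpace (W x)]
  [FiberBundle F' W] [VectorBundle ℝ F' W]

/-! The engine is the invariance of the pairing (`op_pairing`, `op_pairing_sub`): on `L^A` it turns
`d ω_X (l₁, l₂)` into `-({X, l₁}, l₂)_E` (`dLift_omega`). The pairing is also visible in the
bracket, since `𝐛{Y, Z} + 𝐛{Z, Y}` is the section `2 (Y, Z)_E` of `E`. If `l₁, l₂` in `L^A` lie over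
`a₁, a₂`, the brackets `[a₁, X̄a₂]_A`, `[a₂, X̄a₁]_A` and `X̄[a₁, a₂]_A` are `𝐛` of iterated
brackets of `X, l₁, l₂`. The Leibniz identity then collapses `[X̄a₁, a₂]_A + [a₁, X̄a₂]_A - X̄[a₁,
a₂]_A` to minus the symmetric part for `{X, l₁}` and `l₂`, which is `2 d ω_X (l₁, l₂)`
(`twist_lift`). As `L^A → A` is onto (`exists_lift`), for a normalizing `X` the equation `𝐛*Ω = d
ω_X` and the formula for `Ω` say the same thing.

That `X` normalizes follows by testing the equation on `A⁰ ⊂ L^A`: there `𝐛*Ω` vanishes, so `A⁰`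
annihilates `𝐛{X, l}`, which must lie in `A`. The two normalizers agree because `A⁰` and `𝐛⁻¹(A)`
are mutually orthogonal and the pairing is invariant.

The deformation statement is algebra in the Lie ring `Γ(A)`. There `2Ω` is the coboundary of the
operator `X̄`, hence a cocycle (`cyclic_twist`), so the term of the Jacobiator of `[·,·]_A + εΩ`
linear in `ε` vanishes. The quadratic term is the Jacobiator of `Ω`, a quarter of the cyclic sum of
the torsion (`cyclic_twist_twist`).

What remains is geometry: enough global sections, connections, extension of bundle maps from `A` to
`TM ⊕ E`, and the passage from operators linear over functions to bundle maps. -/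

/-- A smooth cut-off function that is `1` near `m`, supported in a given neighbourhood of `m`. -/
theorem exists_cutoff_eventually {m : M} {s : Set M} (hs : s ∈ 𝓝 m) :
    ∃ ψ : C^∞⟮I, M; ℝ⟯, (∀ᶠ x in 𝓝 m, ψ x = 1) ∧ tsupport ψ ⊆ s := by
  obtain ⟨f, -, hf⟩ := (SmoothBumpFunction.nhds_basis_tsupport (I := I) m).mem_iff.1 hs
  exact ⟨⟨f, f.contMDiff⟩, f.eventuallyEq_one, hf⟩

theorem section_sum_apply {ι : Type*} (S : Finset ι) (f : ι → Cₛ^∞⟮I; F, V⟯) (m : M) :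
    (∑ i ∈ S, f i) m = ∑ i ∈ S, f i m :=
  map_sum (⟨⟨fun s => s m, rfl⟩, fun _ _ => rfl⟩ : Cₛ^∞⟮I; F, V⟯ →+ V m) f S

theorem function_sum_apply {ι : Type*} (S : Finset ι) (f : ι → C^∞⟮I, M; ℝ⟯) (m : M) :
    (∑ i ∈ S, f i) m = ∑ i ∈ S, f i m :=
  map_sum (ContMDiffMap.evalRingHom m : C^∞⟮I, M; ℝ⟯ →+* ℝ) f S

/-- Near any point, sections are combinations of finitely many global sections, with coefficients
that depend linearly on the section. -/
theorem exists_local_coordinates [FiniteDimensional ℝ F] [ContMDiffVectorBundle ∞ F V I] (m₀ : M) :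
    ∃ (k : ℕ) (l : Fin k → Cₛ^∞⟮I; F, V⟯ →ₗ[C^∞⟮I, M; ℝ⟯] C^∞⟮I, M; ℝ⟯)
      (s : Fin k → Cₛ^∞⟮I; F, V⟯) (g : C^∞⟮I, M; ℝ⟯),
      (∀ᶠ m in 𝓝 m₀, g m = 1) ∧ (∀ j u m, u m = 0 → l j u m = 0) ∧
      ∀ u, g • u = ∑ j, l j u • s j := by
  have : ContMDiffVectorBundle 1 F V I := ContMDiffVectorBundle.of_le (n := ∞) (by simp)
  let e := trivializationAt F V m₀
  have h0 : m₀ ∈ e.baseSet := FiberBundle.mem_baseSet_trivializationAt' m₀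
  let b := Module.finBasis ℝ F
  obtain ⟨ψ, hψ1, hψs⟩ := exists_cutoff_eventually (I := I) (e.open_baseSet.mem_nhds h0)
  have hc (j) (u : Cₛ^∞⟮I; F, V⟯) :
      ContMDiff I 𝓘(ℝ, ℝ) ∞ fun m => ψ m * e.localFrameCoeff I b j m (u m) := by
    refine contMDiff_of_tsupport fun m hm => ?_
    have hm' : m ∈ e.baseSet := hψs (closure_mono (Function.support_mul_subset_left _ _) hm)
    exact (ψ.contMDiff m).mul (contMDiffAt_localFrameCoeff b hm' (u.contMDiff m) j)
  -- One factor `ψ` makes the coordinates global and another makes the frame global, hence `g = ψ²`.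
  refine ⟨_, fun j => { toFun := fun u => ⟨_, hc j u⟩, map_add' := ?_, map_smul' := ?_ },
    fun j => ⟨_, ContMDiffOn.smul_section_of_tsupport ψ.contMDiff.contMDiffOn e.open_baseSet hψs
      (e.contMDiffOn_localFrame_baseSet ∞ b j)⟩, ψ * ψ, ?_, ?_, ?_⟩
  · intro u v; ext m
    change ψ m * _ = ψ m * _ + ψ m * _
    rw [← mul_add, ← map_add]; rfl
  · intro f u; ext m
    change ψ m * (e.localFrameCoeff I b j m (f m • u m)) = f m * (ψ m * _)
    rw [map_smul, smul_eq_mul]; ring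
  · filter_upwards [hψ1] with m hm
    change ψ m * ψ m = 1
    rw [hm, one_mul]
  · intro j u m hu
    change ψ m * e.localFrameCoeff I b j m (u m) = 0
    rw [hu, map_zero, mul_zero]
  · intro u; ext m
    rw [section_sum_apply]
    change (ψ m * ψ m) • u m =
      ∑ j, (ψ m * e.localFrameCoeff I b j m (u m)) • ψ m • e.localFrame b j m
    by_cases hm : m ∈ e.baseSet
    · conv_lhs => rw [e.eq_sum_localFrameCoeff_smul (I := I) (b := b) (s := u) hm, Finset.smul_sum]
      refine Finset.sum_congr rfl fun j _ => ?_
      simp only [smul_smul]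
      congr 1; ring
    · have : ψ m = 0 := by
        by_contra h
        exact hm (hψs (subset_tsupport _ h))
      simp [this]

/-- An operator linear over functions depends only on values. -/
theorem apply_eq_zero_of_linear [FiniteDimensional ℝ F] [ContMDiffVectorBundle ∞ F V I]
    (T : Cₛ^∞⟮I; F, V⟯ →ₗ[C^∞⟮I, M; ℝ⟯] Cₛ^∞⟮I; F', W⟯) {u : Cₛ^∞⟮I; F, V⟯} {m : M}
    (hu : u m = 0) : T u m = 0 := by
  obtain ⟨k, l, s, g, hg, hl, h⟩ := exists_local_coordinates (I := I) (F := F) (V := V) m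
  have h1 : (T (g • u)) m = T u m := by
    rw [map_smul, section_smul_apply, hg.self_of_nhds, one_smul]
  rw [← h1, h, map_sum, section_sum_apply]
  refine Finset.sum_eq_zero fun j _ => ?_
  rw [map_smul, section_smul_apply, hl j u m hu, zero_smul]

/-- Operators `T i` that are defined near the points `i` are glued by a partition of unity. -/
theorem exists_glue [SigmaCompactSpace M] {N : Type*} [AddCommGroup N] [Module ℝ N]
    (T : M → N →ₗ[ℝ] Cₛ^∞⟮I; F', W⟯) (U : M → Set M) (hU : ∀ i, U i ∈ 𝓝 i) :
    ∃ S : N →ₗ[ℝ] Cₛ^∞⟮I; F', W⟯, ∀ m, ∃ (s : Finset M) (w : M → ℝ), (∀ i ∈ s, m ∈ U i) ∧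
      ∑ i ∈ s, w i = 1 ∧ ∀ u, S u m = ∑ i ∈ s, w i • T i u m := by
  -- At `m` only the `T i` with `m ∈ U i` contribute, with weights of sum `1`; affine identities
  -- valid on each `U i` therefore pass to the glued operator.
  obtain ⟨ρ, hρ⟩ := SmoothPartitionOfUnity.exists_isSubordinate I isClosed_univ
    (fun i => interior (U i)) (fun i => isOpen_interior)
    (fun m _ => Set.mem_iUnion.2 ⟨m, mem_interior_iff_mem_nhds.2 (hU m)⟩)
  have hfin (m : M) : (Function.support fun i => ρ i m).Finite := ρ.locallyFinite.point_finite m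
  have hsum (u : N) (m : M) :
      ∑ᶠ i, ρ i m • T i u m = ∑ i ∈ (hfin m).toFinset, ρ i m • T i u m :=
    finsum_eq_sum_of_support_subset _ fun i hi => by
      rw [Set.Finite.coe_toFinset]
      exact fun h => hi (by simp [h])
  have hsm (u : N) : ContMDiff I (I.prod 𝓘(ℝ, F')) ∞
      fun m => TotalSpace.mk' F' m (∑ᶠ i, ρ i m • T i u m) := by
    refine ContMDiff.finsum_section_of_locallyFinite (t := fun i m => ρ i m • T i u m) ?_ ?_
    · refine ρ.locallyFinite.subset fun i m hm h => hm ?_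
      simp [h]
    · exact fun i => (ρ i).contMDiff.smul_section (T i u).contMDiff
  refine ⟨{ toFun := fun u => ⟨_, hsm u⟩, map_add' := ?_, map_smul' := ?_ }, fun m =>
    ⟨(hfin m).toFinset, fun i => ρ i m, ?_, ?_, fun u => hsum u m⟩⟩
  · intro u v; ext m
    change ∑ᶠ i, ρ i m • T i (u + v) m = ∑ᶠ i, ρ i m • T i u m + ∑ᶠ i, ρ i m • T i v m
    rw [hsum, hsum, hsum, ← Finset.sum_add_distrib]
    refine Finset.sum_congr rfl fun i _ => ?_
    rw [← smul_add, map_add]; rfl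
  · intro r u; ext m
    change ∑ᶠ i, ρ i m • T i (r • u) m = r • ∑ᶠ i, ρ i m • T i u m
    rw [hsum, hsum, Finset.smul_sum]
    refine Finset.sum_congr rfl fun i _ => ?_
    rw [smul_comm, map_smul]; rfl
  · intro i hi
    exact interior_subset (hρ i (subset_tsupport _ ((hfin m).mem_toFinset.1 hi)))
  · rw [← ρ.sum_eq_one (Set.mem_univ m)]
    exact (finsum_eq_sum_of_support_subset _ (by rw [Set.Finite.coe_toFinset])).symm

end LocalTools

/-! ### Existence of lifts -/

section Lifts

variable {B : Type*} [NormedAddCommGroup B] [NormedSpace ℝ B] [FiniteDimensional ℝ B]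
  {H : Type*} [TopologicalSpace H] {I : ModelWithCorners ℝ B H}
  {M : Type*} [TopologicalSpace M] [ChartedSpace H M] [IsManifold I ∞ M] [T2Space M]
  {F : Type*} [NormedAddCommGroup F] [NormedSpace ℝ F]
  {E : M → Type*} [TopologicalSpace (TotalSpace F E)]
  [∀ x, AddCommGroup (E x)] [∀ x, Module ℝ (E x)] [∀ x : M, TopologicalSpace (E x)]
  [FiberBundle F E] [VectorBundle ℝ F E]

theorem VF.deriv_add (x : VF I M) (f g : C^∞⟮I, M; ℝ⟯) :
    x.deriv (f + g) = x.deriv f + x.deriv g := by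
  ext m
  have h := mvfderiv_add (mdiffAt_fun (I := I) f m) (mdiffAt_fun g m)
  exact congrArg (fun φ : TangentSpace I m →L[ℝ] ℝ => φ (x m)) h

theorem TSec.ext_eval {s t : TSec I F E} (h : ∀ m, s.eval m = t.eval m) : s = t :=
  Prod.ext (by ext m; exact congrArg Prod.fst (h m)) (by ext m; exact congrArg Prod.snd (h m))

theorem TSec.eval_add (s t : TSec I F E) (m : M) : (s + t).eval m = s.eval m + t.eval m := rfl

theorem TSec.eval_sub (s t : TSec I F E) (m : M) : (s - t).eval m = s.eval m - t.eval m := rfl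

theorem TSec.eval_smul (f : C^∞⟮I, M; ℝ⟯) (t : TSec I F E) (m : M) :
    (f • t).eval m = f m • t.eval m := rfl

theorem TSec.eval_sum {ι : Type*} (S : Finset ι) (t : ι → TSec I F E) (m : M) :
    (∑ i ∈ S, t i).eval m = ∑ i ∈ S, (t i).eval m :=
  map_sum (⟨⟨fun s => s.eval m, rfl⟩, fun _ _ => rfl⟩ : TSec I F E →+ TangentSpace I m × E m) t S

variable [FiniteDimensional ℝ F] [ContMDiffVectorBundle ∞ F E I]

/-- The anchor `Γ(𝔇E) → 𝔛(M)` is surjective: vector bundles have connections. -/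
theorem GaugeSec.exists_anchor_eq [SigmaCompactSpace M] (x : VF I M) :
    ∃ d : GaugeSec I F E, d.anchor = x := by
  choose k l s g hg hl h using fun m : M => exists_local_coordinates (I := I) (F := F) (V := E) m
  -- Differentiating the local coefficients along `x` gives a derivation up to the cut-off: its
  -- symbol is `g i • x`, correct where `g i = 1`.
  let T (i : M) : Cₛ^∞⟮I; F, E⟯ →ₗ[ℝ] Cₛ^∞⟮I; F, E⟯ :=
    { toFun := fun u => ∑ j, x.deriv (l i j u) • s i j
      map_add' := fun u v => by
        simp only [map_add, VF.deriv_add, add_smul, Finset.sum_add_distrib]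
      map_smul' := fun r u => by
        simp only [LinearMap.map_smul_of_tower, VF.deriv_const_smul, smul_assoc,
          ← Finset.smul_sum, RingHom.id_apply] }
  have hT (i : M) (f : C^∞⟮I, M; ℝ⟯) (u) : T i (f • u) = f • T i u + x.deriv f • g i • u := by
    change ∑ j, x.deriv (l i j (f • u)) • s i j = f • ∑ j, x.deriv (l i j u) • s i j + _
    rw [h i u, Finset.smul_sum, Finset.smul_sum, ← Finset.sum_add_distrib]
    refine Finset.sum_congr rfl fun j _ => ?_
    rw [map_smul, smul_eq_mul, VF.deriv_mul, add_smul, mul_smul, smul_smul (x.deriv f), mul_comm (l i j u)]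
  obtain ⟨S, hS⟩ := exists_glue T _ hg
  refine ⟨⟨(x, S), fun f u => ?_⟩, rfl⟩
  ext m
  obtain ⟨t, w, h1, h2, h3⟩ := hS m
  change S (f • u) m = f m • S u m + x.deriv f m • u m
  have h4 : x.deriv f m • u m = ∑ i ∈ t, w i • x.deriv f m • u m := by
    rw [← Finset.sum_smul, h2, one_smul]
  rw [h3, h3, h4, Finset.smul_sum, ← Finset.sum_add_distrib]
  refine Finset.sum_congr rfl fun i hi => ?_
  have hgi : g i m = 1 := h1 i hi
  rw [hT]
  change w i • (f m • T i u m + x.deriv f m • g i m • u m) = _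
  rw [hgi, one_smul, smul_add, smul_comm (w i) (f m)]

/-- A connection lifts the vector field and the jet prolongation lifts the section of `E`.
Consequently the default branch of `falling` is never taken. -/
theorem OmniSec.exists_b_eq [SigmaCompactSpace M] (t : TSec I F E) :
    ∃ Y : OmniSec I F E, Y.b = t := by
  obtain ⟨d, hd⟩ := GaugeSec.exists_anchor_eq (F := F) (E := E) t.1
  exact ⟨(d, JetSec.jet t.2), Prod.ext hd rfl⟩

/-- Pairs in `TSec` are not declared as sections of one bundle, so tensoriality is checked on the
`TM` and `E` summands separately. -/
theorem TSec.apply_eq_zero_of_linear (T : TSec I F E →ₗ[C^∞⟮I, M; ℝ⟯] Cₛ^∞⟮I; F, E⟯)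
    {t : TSec I F E} {m : M} (ht : t.eval m = 0) : T t m = 0 := by
  have h1 := OmniLie.apply_eq_zero_of_linear (T ∘ₗ LinearMap.inl _ _ _)
    (u := t.1) (m := m) (congrArg Prod.fst ht)
  have h2 := OmniLie.apply_eq_zero_of_linear (T ∘ₗ LinearMap.inr _ _ _)
    (u := t.2) (m := m) (congrArg Prod.snd ht)
  have h3 : T t = T (t.1, 0) + T (0, t.2) := by rw [← map_add]; simp
  rw [h3]
  exact (congrArg₂ (· + ·) h1 h2).trans (add_zero _)

theorem TSec.exists_eval_eq {m : M} (v : TangentSpace I m × E m) :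
    ∃ t : TSec I F E, t.eval m = v := by
  obtain ⟨x, hx⟩ := exists_section (I := I) (F := B) (V := (TangentSpace I : M → Type _)) v.1
  obtain ⟨u, hu⟩ := exists_section (I := I) (F := F) v.2
  exact ⟨(x, u), Prod.ext hx hu⟩

theorem TSec.apply_congr_of_linear (T : TSec I F E →ₗ[C^∞⟮I, M; ℝ⟯] Cₛ^∞⟮I; F, E⟯)
    {s t : TSec I F E} {m : M} (h : s.eval m = t.eval m) : T s m = T t m := by
  have h1 := TSec.apply_eq_zero_of_linear T (t := s - t) (m := m) (sub_eq_zero.2 h)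
  rw [map_sub] at h1
  exact sub_eq_zero.1 h1

/-- The bundle map `TM ⊕ E → E` given by an operator on sections that is linear over functions. -/
def HomTE.ofLinear (T : TSec I F E →ₗ[C^∞⟮I, M; ℝ⟯] Cₛ^∞⟮I; F, E⟯) : HomTE I F E where
  toFun m :=
    { toFun := fun v => T (TSec.exists_eval_eq v).choose m
      map_add' := fun v w => by
        have h : T (TSec.exists_eval_eq v).choose m + T (TSec.exists_eval_eq w).choose m =
          T ((TSec.exists_eval_eq v).choose + (TSec.exists_eval_eq w).choose) m := by
          rw [map_add]; rfl
        rw [h]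
        refine TSec.apply_congr_of_linear T ?_
        rw [TSec.eval_add, (TSec.exists_eval_eq v).choose_spec,
          (TSec.exists_eval_eq w).choose_spec, (TSec.exists_eval_eq (v + w)).choose_spec]
      map_smul' := fun r v => by
        let c : C^∞⟮I, M; ℝ⟯ := algebraMap ℝ _ r
        have h : r • T (TSec.exists_eval_eq v).choose m =
          T (c • (TSec.exists_eval_eq v).choose) m := by rw [map_smul]; rfl
        rw [RingHom.id_apply, h]
        refine TSec.apply_congr_of_linear T ?_
        rw [TSec.eval_smul, (TSec.exists_eval_eq v).choose_spec,
          (TSec.exists_eval_eq (r • v)).choose_spec]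
        rfl }
  smooth t := by
    have h (m : M) : T (TSec.exists_eval_eq (t.eval m)).choose m = T t m :=
      TSec.apply_congr_of_linear T (TSec.exists_eval_eq (t.eval m)).choose_spec
    simpa only [LinearMap.coe_mk, AddHom.coe_mk, h] using! (T t).contMDiff

theorem HomTE.ofLinear_toFun (T : TSec I F E →ₗ[C^∞⟮I, M; ℝ⟯] Cₛ^∞⟮I; F, E⟯)
    (t : TSec I F E) (m : M) : (HomTE.ofLinear T).toFun m (t.eval m) = T t m :=
  TSec.apply_congr_of_linear T (TSec.exists_eval_eq (t.eval m)).choose_spec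

theorem HomTE.ofLinear_apply (T : TSec I F E →ₗ[C^∞⟮I, M; ℝ⟯] Cₛ^∞⟮I; F, E⟯)
    (t : TSec I F E) : (HomTE.ofLinear T).apply t = T t := by
  ext m; exact HomTE.ofLinear_toFun T t m

/-- The kernel of `𝐛` is `Hom(TM ⊕ E, E)`. -/
theorem OmniSec.exists_homTE_of_b_eq_zero [SigmaCompactSpace M] {Z : OmniSec I F E}
    (hZ : Z.b = 0) : ∃ h : HomTE I F E, h.a = Z := by
  have hα : Z.1.anchor = 0 := congrArg Prod.fst hZ
  have hp : Z.2.proj = 0 := congrArg Prod.snd hZ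
  choose D hD using GaugeSec.exists_anchor_eq (I := I) (F := F) (E := E)
  -- When `𝕡` of the jet part vanishes, the jet condition makes it kill `gl(E)`; it factors through
  -- the anchor, and any choice `D` of derivations over vector fields computes it.
  have hpair (d r : GaugeSec I F E) (h : d.anchor = r.anchor) : Z.2.pair d = Z.2.pair r := by
    have h1 := Z.2.pair_vert (Φ := d - r) (sub_eq_zero.2 h)
    rw [hp, map_zero] at h1
    exact sub_eq_zero.1 ((map_sub Z.2.1 d r).symm.trans h1)
  have hop (f : C^∞⟮I, M; ℝ⟯) (u) : Z.1.op (f • u) = f • Z.1.op u := by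
    rw [GaugeSec.op_smul, hα, VF.zero_deriv, zero_smul, add_zero]
  let T : TSec I F E →ₗ[C^∞⟮I, M; ℝ⟯] Cₛ^∞⟮I; F, E⟯ :=
    { toFun := fun t => Z.1.op t.2 + Z.2.pair (D t.1)
      map_add' := fun s t => by
        have h1 : Z.2.pair (D (s + t).1) = Z.2.pair (D s.1) + Z.2.pair (D t.1) :=
          (hpair _ (D s.1 + D t.1) (by simp [hD])).trans (map_add Z.2.1 _ _)
        rw [h1, Prod.snd_add, map_add]
        abel
      map_smul' := fun f t => by
        have h1 : Z.2.pair (D (f • t).1) = f • Z.2.pair (D t.1) :=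
          (hpair _ (f • D t.1) (by simp [hD])).trans (map_smul Z.2.1 _ _)
        rw [h1, Prod.smul_snd, hop, RingHom.id_apply, smul_add] }
  refine ⟨HomTE.ofLinear T, Prod.ext (GaugeSec.ext' hα.symm fun u => ?_)
    (Subtype.ext (LinearMap.ext fun d => ?_))⟩
  · change (HomTE.ofLinear T).apply (0, u) = _
    have h1 : Z.2.pair (D 0) = 0 := (hpair _ 0 (hD 0)).trans (map_zero Z.2.1)
    rw [HomTE.ofLinear_apply]
    change Z.1.op u + Z.2.pair (D 0) = _
    rw [h1, add_zero]
  · change (HomTE.ofLinear T).apply (d.anchor, 0) = Z.2.pair d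
    rw [HomTE.ofLinear_apply]
    change Z.1.op 0 + Z.2.pair (D d.anchor) = _
    rw [map_zero, zero_add, hpair _ d (hD _)]

/-! ### Subbundles -/

/-- Every vector of a subbundle is the value of a section. -/
theorem Subbundle.exists_eval_eq (A : Subbundle I F E) {m : M} {v : TangentSpace I m × E m}
    (hv : v ∈ A.fibre m) : ∃ a : A.sections, a.1.eval m = v := by
  obtain ⟨k, a, ha, hU⟩ := A.exists_frame m
  rw [← hU.self_of_nhds.2] at hv
  obtain ⟨c, hc⟩ := (Submodule.mem_span_range_iff_exists_fun ℝ).1 hv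
  refine ⟨∑ i, algebraMap ℝ C^∞⟮I, M; ℝ⟯ (c i) • ⟨a i, ha i⟩, ?_⟩
  rw [Submodule.coe_sum, TSec.eval_sum]
  exact hc

/-- Near any point, there is a projection `TM ⊕ E → A`. -/
theorem Subbundle.exists_local_projection (A : Subbundle I F E) (m₀ : M) :
    ∃ (g : C^∞⟮I, M; ℝ⟯) (p : TSec I F E →ₗ[C^∞⟮I, M; ℝ⟯] A.sections),
      (∀ᶠ m in 𝓝 m₀, g m = 1) ∧ ∀ a : A.sections, p a.1 = g • a := by
  classical
  obtain ⟨k, a, haA, hU⟩ := A.exists_frame m₀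
  obtain ⟨l, hl, hl0⟩ := exists_covectors a hU.self_of_nhds.1
  let c : TSec I F E →ₗ[C^∞⟮I, M; ℝ⟯] (Fin k → C^∞⟮I, M; ℝ⟯) :=
    { toFun := fun t j => ⟨fun m => l j m (t.eval m), hl j t⟩
      map_add' := fun s t => by ext j m; exact map_add (l j m) (s.eval m) (t.eval m)
      map_smul' := fun f t => by ext j m; exact map_smul (l j m) (f m) (t.eval m) }
  -- `G` pairs the covectors with the frame and is the identity at `m₀`. The projection finds frame
  -- coefficients by Cramer's rule; the adjugate is defined on all of `M`, and division by `G.det`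
  -- happens only under the cut-off `θ`, inside `κ`.
  let G : Matrix (Fin k) (Fin k) C^∞⟮I, M; ℝ⟯ := Matrix.of fun j i => c (a i) j
  have hG : G.det m₀ = 1 := by
    have h1 : (ContMDiffMap.evalRingHom m₀ : C^∞⟮I, M; ℝ⟯ →+* ℝ) G.det =
      ((ContMDiffMap.evalRingHom m₀ : C^∞⟮I, M; ℝ⟯ →+* ℝ).mapMatrix G).det := RingHom.map_det _ _
    have h2 : (ContMDiffMap.evalRingHom m₀ : C^∞⟮I, M; ℝ⟯ →+* ℝ).mapMatrix G = 1 := by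
      ext j i
      refine (hl0 i j).trans ?_
      simp [Matrix.one_apply, eq_comm]
    rw [h2, Matrix.det_one] at h1
    exact h1
  have hdet : {m | G.det m ≠ 0} ∈ 𝓝 m₀ :=
    (isOpen_ne_fun G.det.contMDiff.continuous continuous_const).mem_nhds (by simp [hG])
  obtain ⟨θ, hθ1, hθs⟩ := exists_cutoff_eventually (I := I) (inter_mem hU hdet)
  have hκ : ContMDiff I 𝓘(ℝ, ℝ) ∞ fun m => θ m * (G.det m)⁻¹ := by
    refine contMDiff_of_tsupport fun m hm => ?_
    have hm' := hθs (closure_mono (Function.support_mul_subset_left _ _) hm)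
    exact (θ.contMDiff m).mul ((G.det.contMDiff m).inv₀ hm'.2)
  let κ : C^∞⟮I, M; ℝ⟯ := ⟨_, hκ⟩
  have hκG (m : M) : κ m * G.det m = θ m := by
    change θ m * (G.det m)⁻¹ * G.det m = θ m
    by_cases h : G.det m = 0
    · have : θ m = 0 := by
        by_contra h'
        exact (hθs (subset_tsupport _ h')).2 h
      simp [this]
    · rw [mul_assoc, inv_mul_cancel₀ h, mul_one]
  let p : TSec I F E →ₗ[C^∞⟮I, M; ℝ⟯] A.sections :=
    ∑ i, (LinearMap.proj i ∘ₗ (κ • G.adjugate).mulVecLin ∘ₗ c).smulRight ⟨a i, haA i⟩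
  refine ⟨θ, p, hθ1, fun t => Subtype.ext (TSec.ext_eval fun m => ?_)⟩
  have hp : (p t.1).1 = ∑ i, (κ * (G.adjugate.mulVec (c t.1)) i) • a i := by
    simp [p, LinearMap.sum_apply]
  rw [hp, TSec.eval_sum]
  change ∑ i, (κ m * (G.adjugate.mulVec (c t.1)) i m) • (a i).eval m = θ m • t.1.eval m
  by_cases hm : θ m = 0
  · have : κ m = 0 := by
      change θ m * _ = 0
      rw [hm, zero_mul]
    simp [this, hm]
  · have hmU := (hθs (subset_tsupport _ hm)).1
    have hsp : t.1.eval m ∈ Submodule.span ℝ (Set.range fun i => (a i).eval m) := by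
      rw [hmU.2]; exact t.2 m
    obtain ⟨γ, hγ⟩ := (Submodule.mem_span_range_iff_exists_fun ℝ).1 hsp
    let Gm : Matrix (Fin k) (Fin k) ℝ :=
      (ContMDiffMap.evalRingHom m : C^∞⟮I, M; ℝ⟯ →+* ℝ).mapMatrix G
    have hb : (fun j => c t.1 j m) = Gm.mulVec γ := by
      ext j
      change l j m (t.1.eval m) = ∑ i, G j i m * γ i
      rw [← hγ, map_sum]
      refine Finset.sum_congr rfl fun i _ => ?_
      rw [map_smul, smul_eq_mul, mul_comm]
      rfl
    have hadj (i : Fin k) : (G.adjugate.mulVec (c t.1)) i m = G.det m * γ i := by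
      have h1 : (G.adjugate.mulVec (c t.1)) i m = (Gm.adjugate.mulVec fun j => c t.1 j m) i := by
        change (∑ j, G.adjugate i j * c t.1 j) m = ∑ j, Gm.adjugate i j * c t.1 j m
        rw [function_sum_apply, ← RingHom.map_adjugate]
        rfl
      have h2 : Gm.det = G.det m := (RingHom.map_det _ _).symm
      rw [h1, hb, Matrix.mulVec_mulVec, Matrix.adjugate_mul, h2, Matrix.smul_mulVec,
        Matrix.one_mulVec]
      rfl
    rw [← hγ, Finset.smul_sum]
    refine Finset.sum_congr rfl fun i _ => ?_
    rw [hadj, ← mul_assoc, hκG, mul_smul]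

/-- Bundle maps `A → E` extend to `TM ⊕ E`. -/
theorem Subbundle.exists_homTE_extension [SigmaCompactSpace M] (A : Subbundle I F E)
    (D : A.sections →ₗ[C^∞⟮I, M; ℝ⟯] Cₛ^∞⟮I; F, E⟯) :
    ∃ h : HomTE I F E, ∀ a : A.sections, h.apply a.1 = D a := by
  choose g p hg hp using A.exists_local_projection
  -- The glued operator is a priori only `ℝ`-linear; linearity over functions is read off pointwise
  -- from the weighted sums.
  obtain ⟨S, hS⟩ := exists_glue (fun i => (D ∘ₗ p i).restrictScalars ℝ) _ hg
  let T : TSec I F E →ₗ[C^∞⟮I, M; ℝ⟯] Cₛ^∞⟮I; F, E⟯ :=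
    { S with
      map_smul' := fun f t => by
        ext m
        obtain ⟨s, w, h1, h2, h3⟩ := hS m
        change S (f • t) m = f m • S t m
        rw [h3, h3, Finset.smul_sum]
        refine Finset.sum_congr rfl fun i _ => ?_
        rw [smul_comm (f m)]
        change w i • (D (p i (f • t))) m = w i • f m • D (p i t) m
        rw [map_smul, map_smul]
        rfl }
  refine ⟨HomTE.ofLinear T, fun a => ?_⟩
  rw [HomTE.ofLinear_apply]
  ext m
  obtain ⟨s, w, h1, h2, h3⟩ := hS m
  refine (h3 a.1).trans ?_
  rw [← one_smul ℝ (D a m), ← h2, Finset.sum_smul]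
  refine Finset.sum_congr rfl fun i hi => ?_
  have hgi : g i m = 1 := h1 i hi
  change w i • D (p i a.1) m = _
  rw [hp, map_smul, section_smul_apply, hgi, one_smul]

/-- The annihilator of `A` separates the vectors outside `A` from `A`. -/
theorem Subbundle.exists_annihilator_ne_zero [Nontrivial F] (A : Subbundle I F E) {m : M}
    {v : TangentSpace I m × E m} (hv : v ∉ A.fibre m) :
    ∃ h : HomTE I F E, (∀ m, ∀ v ∈ A.fibre m, h.toFun m v = 0) ∧ h.toFun m v ≠ 0 := by
  obtain ⟨g, p, hg, hp⟩ := A.exists_local_projection m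
  obtain ⟨t, ht⟩ := TSec.exists_eval_eq (F := F) (E := E) v
  -- The complementary projection, up to the cut-off: it kills `Γ(A)` but not a section through `v`,
  -- so any map to `E` that is nonzero on `R t` at `m` can be composed with it.
  let R : TSec I F E →ₗ[C^∞⟮I, M; ℝ⟯] TSec I F E := g • LinearMap.id - A.sections.subtype ∘ₗ p
  have hR (a : A.sections) : R a.1 = 0 := by
    change g • a.1 - (p a.1).1 = 0
    rw [hp]
    exact sub_self _
  have hRt : (R t).eval m ≠ 0 := by
    change g m • t.eval m - (p t).1.eval m ≠ 0
    rw [hg.self_of_nhds, one_smul, ht, sub_ne_zero]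
    exact fun h => hv (h ▸ (p t).2 m)
  suffices h : ∃ l : TSec I F E →ₗ[C^∞⟮I, M; ℝ⟯] Cₛ^∞⟮I; F, E⟯, l (R t) m ≠ 0 by
    obtain ⟨l, hl⟩ := h
    refine ⟨HomTE.ofLinear (l ∘ₗ R), fun m' w hw => ?_, ?_⟩
    · obtain ⟨a, rfl⟩ := A.exists_eval_eq hw
      rw [HomTE.ofLinear_toFun, LinearMap.comp_apply, hR, map_zero]
      rfl
    · rw [← ht, HomTE.ofLinear_toFun]
      exact hl
  by_cases h2 : (R t).2 m = 0
  · have h1 : (R t).1 m ≠ 0 := fun h => hRt (Prod.ext h h2)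
    obtain ⟨k, l, s, χ, hχ, -, h⟩ := exists_local_coordinates (I := I) (F := B)
      (V := (TangentSpace I : M → Type _)) m
    have hj : ∃ j, l j (R t).1 m ≠ 0 := by
      by_contra! h0
      have h3 := congrArg (fun x : VF I M => x m) (h (R t).1)
      simp only [section_smul_apply, section_sum_apply, hχ.self_of_nhds, h0, one_smul, zero_smul,
        Finset.sum_const_zero] at h3
      exact h1 h3
    obtain ⟨j, hj⟩ := hj
    -- Positive rank enters here: if `R t` is purely tangential at `m`, a covector must be
    -- multiplied by a nonzero vector of `E` to detect it.
    obtain ⟨y, hy⟩ := exists_ne (0 : F)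
    let e := (trivializationAt F E m).linearEquivAt ℝ m
      (FiberBundle.mem_baseSet_trivializationAt' m)
    obtain ⟨u, hu⟩ := exists_section (I := I) (F := F) (V := E) (m := m) (e.symm y)
    refine ⟨((l j).smulRight u) ∘ₗ LinearMap.fst _ _ _, ?_⟩
    change l j (R t).1 m • u m ≠ 0
    rw [hu]
    exact smul_ne_zero hj (e.symm.map_ne_zero_iff.2 hy)
  · exact ⟨LinearMap.snd _ _ _, h2⟩

end Lifts

/-! ### Identities of the omni-Lie algebroid -/

section Identities

variable {B : Type*} [NormedAddCommGroup B] [NormedSpace ℝ B] [FiniteDimensional ℝ B]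
  {H : Type*} [TopologicalSpace H] {I : ModelWithCorners ℝ B H}
  {M : Type*} [TopologicalSpace M] [ChartedSpace H M] [IsManifold I ∞ M] [T2Space M]
  {F : Type*} [NormedAddCommGroup F] [NormedSpace ℝ F]
  {E : M → Type*} [TopologicalSpace (TotalSpace F E)]
  [∀ x, AddCommGroup (E x)] [∀ x, Module ℝ (E x)] [∀ x : M, TopologicalSpace (E x)]
  [FiberBundle F E] [VectorBundle ℝ F E]

theorem VF.bracket_add_left (x y z : VF I M) :
    (x + y).bracket z = x.bracket z + y.bracket z := by
  rw [VF.bracket_skew, VF.bracket_add, VF.bracket_skew z x, VF.bracket_skew z y]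
  abel

theorem VF.zero_bracket (x : VF I M) : (0 : VF I M).bracket x = 0 := by
  simpa using VF.bracket_add_left 0 0 x

namespace JetSec

theorem pair_bracket_skew (μ : JetSec I F E) (d r : GaugeSec I F E) :
    μ.pair (d.bracket r) = - μ.pair (r.bracket d) := by
  have h : d.bracket r = - r.bracket d :=
    GaugeSec.ext' (VF.bracket_skew _ _) fun u => (neg_sub _ _).symm
  rw [h]
  exact map_neg μ.1 _

theorem pair_dorfman (X Y : OmniSec I F E) (e : GaugeSec I F E) :
    (X.dorfman Y).2.pair e = X.1.op (Y.2.pair e) - Y.2.pair (X.1.bracket e) -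
      (Y.1.op (X.2.pair e) - X.2.pair (Y.1.bracket e)) + e.op (X.2.pair Y.1) := rfl

end JetSec

namespace OmniSec

theorem b_add (X Y : OmniSec I F E) : (X + Y).b = X.b + Y.b := rfl

theorem b_smul (f : C^∞⟮I, M; ℝ⟯) (X : OmniSec I F E) : (f • X).b = f • X.b := rfl

/-- The pairing is invariant: `X(Y, Z)_E = ({X, Y}, Z)_E + (Y, {X, Z})_E`. -/
theorem op_pairing (X Y Z : OmniSec I F E) :
    X.1.op (Y.pairing Z) = (X.dorfman Y).pairing Z + Y.pairing (X.dorfman Z) := by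
  simp only [pairing, map_smul, map_add, ← smul_add]
  congr 1
  change _ = Z.2.pair (X.1.bracket Y.1) + (X.dorfman Y).2.pair Z.1 +
    ((X.dorfman Z).2.pair Y.1 + Y.2.pair (X.1.bracket Z.1))
  rw [JetSec.pair_dorfman, JetSec.pair_dorfman, JetSec.pair_bracket_skew X.2 Z.1 Y.1]
  abel

/-- The differential of the cochain `(X, ·)_E`. -/
theorem op_pairing_sub (X Y Z : OmniSec I F E) :
    Y.1.op (X.pairing Z) - Z.1.op (X.pairing Y) - X.pairing (Y.dorfman Z) =
      - (X.dorfman Y).pairing Z := by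
  simp only [pairing, map_smul, map_add, ← smul_sub, ← smul_neg]
  congr 1
  change _ - ((Y.dorfman Z).2.pair X.1 + X.2.pair (Y.1.bracket Z.1)) =
    -(Z.2.pair (X.1.bracket Y.1) + (X.dorfman Y).2.pair Z.1)
  rw [JetSec.pair_dorfman, JetSec.pair_dorfman, JetSec.pair_bracket_skew Z.2 Y.1 X.1,
    JetSec.pair_bracket_skew Y.2 Z.1 X.1]
  abel

/-- The symmetric part of the bracket is `𝕕` of the pairing. -/
theorem b_dorfman_add_swap (X Y : OmniSec I F E) :
    (X.dorfman Y).b + (Y.dorfman X).b = (0, (2 : ℝ) • X.pairing Y) := by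
  rw [b_dorfman, b_dorfman, pairing, smul_smul, mul_one_div_cancel two_ne_zero, one_smul]
  refine Prod.ext ?_ ?_
  · change X.b.1.bracket Y.b.1 + Y.b.1.bracket X.b.1 = 0
    rw [VF.bracket_skew]
    exact neg_add_cancel _
  · change X.1.op Y.b.2 - Y.1.op X.b.2 + X.2.pair Y.1 +
      (Y.1.op X.b.2 - X.1.op Y.b.2 + Y.2.pair X.1) = Y.2.pair X.1 + X.2.pair Y.1
    abel

theorem b_add_dorfman (X Y Z : OmniSec I F E) :
    ((X + Y).dorfman Z).b = (X.dorfman Z).b + (Y.dorfman Z).b := by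
  simp only [b_dorfman, b_add]
  refine Prod.ext (VF.bracket_add_left _ _ _) ?_
  change X.1.op Z.b.2 + Y.1.op Z.b.2 - Z.1.op (X.b.2 + Y.b.2) + (X.2.pair Z.1 + Y.2.pair Z.1) =
    X.1.op Z.b.2 - Z.1.op X.b.2 + X.2.pair Z.1 + (Y.1.op Z.b.2 - Z.1.op Y.b.2 + Y.2.pair Z.1)
  rw [map_add]
  abel

theorem b_dorfman_add (X Y Z : OmniSec I F E) :
    (X.dorfman (Y + Z)).b = (X.dorfman Y).b + (X.dorfman Z).b := by
  simp only [b_dorfman, b_add]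
  refine Prod.ext (VF.bracket_add _ _ _) ?_
  change X.1.op (Y.b.2 + Z.b.2) - (Y.1.op X.b.2 + Z.1.op X.b.2) + X.2.1 (Y.1 + Z.1) =
    X.1.op Y.b.2 - Y.1.op X.b.2 + X.2.pair Y.1 + (X.1.op Z.b.2 - Z.1.op X.b.2 + X.2.pair Z.1)
  rw [map_add, map_add]
  change _ + (X.2.pair Y.1 + X.2.pair Z.1) = _
  abel

theorem b_dorfman_smul (X : OmniSec I F E) (f : C^∞⟮I, M; ℝ⟯) (Y : OmniSec I F E) :
    (X.dorfman (f • Y)).b = f • (X.dorfman Y).b + X.1.anchor.deriv f • Y.b := by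
  simp only [b_dorfman, b_smul]
  refine Prod.ext (VF.bracket_smul _ _ _) ?_
  change X.1.op (f • Y.b.2) - f • Y.1.op X.b.2 + X.2.1 (f • Y.1) =
    f • (X.1.op Y.b.2 - Y.1.op X.b.2 + X.2.pair Y.1) + X.1.anchor.deriv f • Y.b.2
  rw [GaugeSec.op_smul, map_smul X.2.1, smul_add, smul_sub]
  change _ + f • X.2.pair Y.1 = _
  abel

end OmniSec

namespace HomTE

theorem apply_zero (h : HomTE I F E) : h.apply 0 = 0 := by
  ext m; exact map_zero (h.toFun m)

theorem b_a (h : HomTE I F E) : h.a.b = 0 := Prod.ext rfl h.apply_zero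

theorem apply_split (h : HomTE I F E) (t : TSec I F E) :
    h.apply (0, t.2) + h.apply (t.1, 0) = h.apply t := by
  rw [← apply_add]; simp

/-- The jet condition evaluates the jet part of `Y` on the `gl(E)` part of `h`, and the `Hom(TM, E)`
part of `h` sees only the anchor of `Y`. Thus `A⁰` is orthogonal to `𝐛⁻¹(A)`. -/
theorem pairing_a (h : HomTE I F E) (Y : OmniSec I F E) :
    h.a.pairing Y = (1 / 2 : ℝ) • h.apply Y.b := by
  rw [OmniSec.pairing, Y.2.pair_vert (Φ := h.a.1) rfl, ← h.apply_split]
  rfl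

theorem pairing_a_right (h : HomTE I F E) (Y : OmniSec I F E) :
    Y.pairing h.a = (1 / 2 : ℝ) • h.apply Y.b := by
  rw [← pairing_a, OmniSec.pairing, OmniSec.pairing, add_comm]

/-- The falling of an element of `ker 𝐛` is that bundle map itself, followed by `E ⊂ TM ⊕ E`. Adding
such an element to a section thus adjusts its falling by an arbitrary bundle map. -/
theorem b_a_dorfman (h : HomTE I F E) (Y : OmniSec I F E) :
    (h.a.dorfman Y).b = (0, h.apply Y.b) := by
  rw [OmniSec.b_dorfman, b_a, ← h.apply_split Y.b]
  refine Prod.ext (VF.zero_bracket _) ?_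
  change h.apply (0, Y.b.2) - Y.1.op 0 + h.apply (Y.b.1, 0) = _
  rw [map_zero, sub_zero]

end HomTE

/-! ### Fallings as derivations, and the equality of the normalizers -/

section Falling

variable [FiniteDimensional ℝ F] [ContMDiffVectorBundle ∞ F E I] [SigmaCompactSpace M]

namespace OmniSec

theorem falling_add (X : OmniSec I F E) (s t : TSec I F E) :
    X.falling (s + t) = X.falling s + X.falling t := by
  obtain ⟨Y, rfl⟩ := exists_b_eq s
  obtain ⟨Z, rfl⟩ := exists_b_eq t
  rw [← b_add, falling_b, falling_b, falling_b, b_dorfman_add]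

/-- The falling is a derivation with symbol `α(X)`, so differences of fallings and other derivations
with the same symbol are tensorial. -/
theorem falling_smul (X : OmniSec I F E) (f : C^∞⟮I, M; ℝ⟯) (t : TSec I F E) :
    X.falling (f • t) = f • X.falling t + X.1.anchor.deriv f • t := by
  obtain ⟨Y, rfl⟩ := exists_b_eq t
  rw [← b_smul, falling_b, falling_b, b_dorfman_smul]

theorem falling_fst (X : OmniSec I F E) (t : TSec I F E) :
    (X.falling t).1 = X.b.1.bracket t.1 := by
  obtain ⟨Y, rfl⟩ := exists_b_eq t
  rw [falling_b, b_dorfman]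

theorem falling_zero (X : OmniSec I F E) : X.falling 0 = 0 := by
  simpa using X.falling_add 0 0

end OmniSec

/-- A section of `TM ⊕ E` annihilated by `A⁰` is a section of `A`. -/
theorem Subbundle.mem_sections_of_annihilator [Nontrivial F] (A : Subbundle I F E)
    {t : TSec I F E} (ht : ∀ h : HomTE I F E, (∀ m, ∀ v ∈ A.fibre m, h.toFun m v = 0) →
      h.apply t = 0) : t ∈ A.sections := by
  intro m
  by_contra hv
  obtain ⟨h, h1, h2⟩ := A.exists_annihilator_ne_zero hv
  exact h2 (congrArg (fun u : Cₛ^∞⟮I; F, E⟯ => u m) (ht h h1))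

theorem Subbundle.annihilator_apply {A : Subbundle I F E} {h : HomTE I F E}
    (hA : ∀ m, ∀ v ∈ A.fibre m, h.toFun m v = 0) {t : TSec I F E} (ht : t ∈ A.sections) :
    h.apply t = 0 := by
  ext m; exact hA m _ (ht m)

theorem smul_half_eq_zero {u : Cₛ^∞⟮I; F, E⟯} (h : (1 / 2 : ℝ) • u = 0) : u = 0 :=
  (smul_eq_zero.1 h).resolve_left (by norm_num)

/-- The normalizers of `A⁰` and `𝐛⁻¹(A)` coincide. -/
theorem Subbundle.normalizer_annihilator [Nontrivial F] (A : Subbundle I F E) :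
    OmniSec.normalizer A.annihilator = OmniSec.normalizer A.preimage := by
  ext X
  constructor
  · intro hX Y hY
    refine A.mem_sections_of_annihilator fun h hA => smul_half_eq_zero ?_
    obtain ⟨h', hA', e'⟩ := hX h.a ⟨h, hA, rfl⟩
    -- Invariance applied to the zero pairing of `A⁰` with `𝐛⁻¹(A)`: the terms with `{X, h.a}` and
    -- `{X, Y}` sum to zero, and the hypothesis kills the first.
    have key := X.op_pairing h.a Y
    rw [← e', h'.pairing_a, h.pairing_a, h.pairing_a, annihilator_apply hA hY,
      annihilator_apply hA' hY, smul_zero, map_zero, zero_add] at key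
    exact key.symm
  · rintro hX _ ⟨h, hA, rfl⟩
    -- The bracket stays in `ker 𝐛` because `X̄` sends `0 = 𝐛(h.a)` to `0`; only then does it come
    -- from a bundle map.
    have hZ : (X.dorfman h.a).b = 0 := by
      rw [← OmniSec.falling_b, h.b_a, OmniSec.falling_zero]
    obtain ⟨h', e'⟩ := OmniSec.exists_homTE_of_b_eq_zero hZ
    refine ⟨h', fun m v hv => ?_, e'⟩
    obtain ⟨a, rfl⟩ := A.exists_eval_eq hv
    obtain ⟨Y, hY⟩ := OmniSec.exists_b_eq a.1
    have hYA : Y ∈ A.preimage := by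
      change Y.b ∈ A.sections
      rw [hY]; exact a.2
    have key := X.op_pairing h.a Y
    rw [← e', h'.pairing_a, h.pairing_a, h.pairing_a, annihilator_apply hA hYA,
      annihilator_apply hA (hX Y hYA), smul_zero, map_zero, add_zero] at key
    have h0 := smul_half_eq_zero key.symm
    rw [hY] at h0
    exact congrArg (fun u : Cₛ^∞⟮I; F, E⟯ => u m) h0

end Falling

end Identities

/-! ### Deformations of Lie brackets by trivial cocycles -/

section Deformation

variable {L : Type*} [AddCommGroup L] (br : L → L → L) (N : L → L)

/-- For an additive operator `N` on a Lie ring, `[Na, b] + [a, Nb] - N[a, b]` is a cocycle. -/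
theorem cyclic_twist (add_left : ∀ a b c, br (a + b) c = br a c + br b c)
    (jacobi : ∀ a b c, br (br a b) c + br (br b c) a + br (br c a) b = 0)
    (hN : ∀ a b, N (a + b) = N a + N b) (tw : L → L → L)
    (htw : ∀ a b, tw a b = br (N a) b + br a (N b) - N (br a b)) (a b c : L) :
    (br (tw a b) c + tw (br a b) c) + (br (tw b c) a + tw (br b c) a) +
      (br (tw c a) b + tw (br c a) b) = 0 := by
  have sub_left (a b c : L) : br (a - b) c = br a c - br b c := by
    rw [eq_sub_iff_add_eq, ← add_left, sub_add_cancel]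
  have hN0 : N 0 = 0 := by simpa using hN 0 0
  -- This is `d² = 0` for the adjoint complex: the Jacobi identity with `N` in each slot in turn,
  -- minus `N` of the Jacobi identity.
  have j1 := jacobi (N a) b c
  have j2 := jacobi a (N b) c
  have j3 := jacobi a b (N c)
  have j4 := congrArg N (jacobi a b c)
  simp only [hN, hN0] at j4
  simp only [htw, add_left, sub_left]
  linear_combination (norm := module) j1 + j2 + j3 - j4

/-- The Jacobiator of `[Na, b] + [a, Nb] - N[a, b]` in terms of the torsion of `N`. -/
theorem cyclic_twist_twist (add_left : ∀ a b c, br (a + b) c = br a c + br b c)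
    (jacobi : ∀ a b c, br (br a b) c + br (br b c) a + br (br c a) b = 0)
    (hN : ∀ a b, N (a + b) = N a + N b) (tw T : L → L → L)
    (htw : ∀ a b, tw a b = br (N a) b + br a (N b) - N (br a b))
    (hT : ∀ a b, T a b = N (tw a b) - br (N a) (N b)) (a b c : L) :
    tw (tw a b) c + tw (tw b c) a + tw (tw c a) b =
      (br (T a b) c + T (br a b) c) + (br (T b c) a + T (br b c) a) +
      (br (T c a) b + T (br c a) b) := by
  have sub_left (a b c : L) : br (a - b) c = br a c - br b c := by
    rw [eq_sub_iff_add_eq, ← add_left, sub_add_cancel]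
  have hN0 : N 0 = 0 := by simpa using hN 0 0
  have h := congrArg N (cyclic_twist br N add_left jacobi hN tw htw a b c)
  simp only [hN, hN0] at h
  -- The Jacobi identity with `N` in two slots accounts for the products of two `N`'s in the
  -- torsion; all terms with an outer `N` are `N` of the cocycle identity `h`.
  have j1 := jacobi (N a) (N b) c
  have j2 := jacobi a (N b) (N c)
  have j3 := jacobi (N a) b (N c)
  -- The inner twist is expanded only in the middle term, so that the other terms still match the
  -- torsion and `h`.
  have e (a b c : L) : tw (tw a b) c = br (N (tw a b)) c + (br (br (N a) b) (N c) +
      br (br a (N b)) (N c) - br (N (br a b)) (N c)) - N (br (tw a b) c) := by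
    rw [htw (tw a b) c]
    congr 2
    rw [htw a b, sub_left, add_left]
  simp only [e, hT, sub_left]
  linear_combination (norm := module) j1 + j2 + j3 - h

end Deformation

/-! ### Deformations of projective Lie algebroids by fallings -/

section Main

variable {B : Type*} [NormedAddCommGroup B] [NormedSpace ℝ B] [FiniteDimensional ℝ B]
  {H : Type*} [TopologicalSpace H] {I : ModelWithCorners ℝ B H}
  {M : Type*} [TopologicalSpace M] [ChartedSpace H M] [IsManifold I ∞ M] [T2Space M]
  {F : Type*} [NormedAddCommGroup F] [NormedSpace ℝ F]
  {E : M → Type*} [TopologicalSpace (TotalSpace F E)]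
  [∀ x, AddCommGroup (E x)] [∀ x, Module ℝ (E x)] [∀ x : M, TopologicalSpace (E x)]
  [FiberBundle F E] [VectorBundle ℝ F E]

section Bracket

variable {A : Subbundle I F E} {br : A.sections → A.sections → A.sections}

namespace Subbundle.IsLieAlgebroidBracket

theorem add_left (h : A.IsLieAlgebroidBracket br) (a b c : A.sections) :
    br (a + b) c = br a c + br b c := by
  rw [h.skew, h.add_right, h.skew c a, h.skew c b]
  abel

theorem smul_left (h : A.IsLieAlgebroidBracket br) (r : ℝ) (a b : A.sections) :
    br (r • a) b = r • br a b := by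
  rw [h.skew, h.smul_right, h.skew b a, smul_neg, neg_neg]

theorem zero_left (h : A.IsLieAlgebroidBracket br) (a : A.sections) : br 0 a = 0 := by
  simpa using h.add_left 0 0 a

end Subbundle.IsLieAlgebroidBracket

end Bracket

namespace Subbundle.TwoForm

variable {A : Subbundle I F E} (Ω : A.TwoForm)

theorem apply_add_right (a b c : A.sections) :
    Ω.apply a (b + c) = Ω.apply a b + Ω.apply a c := by
  refine Subtype.ext (Prod.ext (add_zero _).symm ?_)
  ext m
  exact map_add (Ω.toFun m ⟨a.1.eval m, a.2 m⟩) ⟨b.1.eval m, b.2 m⟩ ⟨c.1.eval m, c.2 m⟩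

theorem apply_smul_right (a : A.sections) (f : C^∞⟮I, M; ℝ⟯) (b : A.sections) :
    Ω.apply a (f • b) = f • Ω.apply a b := by
  refine Subtype.ext (Prod.ext (smul_zero f).symm ?_)
  ext m
  exact map_smul (Ω.toFun m ⟨a.1.eval m, a.2 m⟩) (f m) ⟨b.1.eval m, b.2 m⟩

theorem apply_const_smul_right (a : A.sections) (r : ℝ) (b : A.sections) :
    Ω.apply a (r • b) = r • Ω.apply a b := by
  refine Subtype.ext (Prod.ext (smul_zero r).symm ?_)
  ext m
  exact map_smul (Ω.toFun m ⟨a.1.eval m, a.2 m⟩) r ⟨b.1.eval m, b.2 m⟩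

theorem apply_skew (a b : A.sections) : Ω.apply a b = - Ω.apply b a := by
  refine Subtype.ext (Prod.ext neg_zero.symm ?_)
  ext m
  have h := Ω.alt m (⟨a.1.eval m, a.2 m⟩ + ⟨b.1.eval m, b.2 m⟩)
  rw [map_add, map_add, LinearMap.add_apply, LinearMap.add_apply, Ω.alt, Ω.alt, zero_add,
    add_zero] at h
  exact eq_neg_of_add_eq_zero_right h

theorem apply_add_left (a b c : A.sections) :
    Ω.apply (a + b) c = Ω.apply a c + Ω.apply b c := by
  rw [apply_skew, apply_add_right, Ω.apply_skew c a, Ω.apply_skew c b]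
  abel

theorem apply_const_smul_left (r : ℝ) (a b : A.sections) :
    Ω.apply (r • a) b = r • Ω.apply a b := by
  rw [apply_skew, apply_const_smul_right, Ω.apply_skew b a, smul_neg, neg_neg]

end Subbundle.TwoForm

variable [FiniteDimensional ℝ F] [ContMDiffVectorBundle ∞ F E I] [SigmaCompactSpace M]

namespace ProjLieAlgebroid

variable (A : ProjLieAlgebroid I F E)

/-! ### Tensoriality of the twist, and the Jacobi identity of the deformed bracket -/

section Falling

variable {X : OmniSec I F E} (hX : X ∈ OmniSec.normalizer A.preimage)

theorem fallingOn_add (a b : A.sections) :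
    A.fallingOn hX (a + b) = A.fallingOn hX a + A.fallingOn hX b :=
  Subtype.ext (X.falling_add a.1 b.1)

theorem fallingOn_smul (f : C^∞⟮I, M; ℝ⟯) (a : A.sections) :
    A.fallingOn hX (f • a) = f • A.fallingOn hX a + X.1.anchor.deriv f • a :=
  Subtype.ext (X.falling_smul f a.1)

theorem twist_skew (a b : A.sections) : A.twist hX a b = - A.twist hX b a := by
  have h : A.fallingOn hX (A.bracket a b) = - A.fallingOn hX (A.bracket b a) := by
    have h0 : A.fallingOn hX 0 = 0 := Subtype.ext X.falling_zero
    rw [eq_neg_iff_add_eq_zero, ← fallingOn_add, A.isLie.skew a b, neg_add_cancel, h0]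
  rw [twist, twist, h, A.isLie.skew _ b, A.isLie.skew a]
  abel

theorem twist_add_right (a b c : A.sections) :
    A.twist hX a (b + c) = A.twist hX a b + A.twist hX a c := by
  simp only [twist, fallingOn_add, A.isLie.add_right]
  abel

/-- First-order terms cancel in pairs because `X̄` and `[a, ·]_A` are derivations. The remaining
coefficient of `b` vanishes since the anchor of `X̄a` is the commutator of `α(X)` with the anchor of
`a`. -/
theorem twist_smul_right (a : A.sections) (f : C^∞⟮I, M; ℝ⟯) (b : A.sections) :
    A.twist hX a (f • b) = f • A.twist hX a b := by
  have h1 : (A.fallingOn hX a).1.1.deriv f =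
      X.1.anchor.deriv (a.1.1.deriv f) - a.1.1.deriv (X.1.anchor.deriv f) := by
    rw [← VF.bracket_deriv]
    exact congrArg (fun x : VF I M => x.deriv f) (X.falling_fst a.1)
  have h2 : (A.fallingOn hX a).1.1.deriv f • b =
      X.1.anchor.deriv (a.1.1.deriv f) • b - a.1.1.deriv (X.1.anchor.deriv f) • b := by
    rw [h1]
    exact sub_smul _ _ b
  simp only [twist, fallingOn_add, fallingOn_smul, A.isLie.add_right, A.isLie.leibniz, h2,
    smul_add, smul_sub]
  abel

/-- If `2Ω` is the coboundary of `X̄`, then `Ω` generates a deformation iff the torsion of `X̄`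
satisfies the cyclic condition. -/
theorem generatesDeformation_iff (Ω : A.TwoForm)
    (h : ∀ a b, Ω.apply a b = (1 / 2 : ℝ) • A.twist hX a b) :
    A.GeneratesDeformation Ω ↔ A.TorsionCyclic hX := by
  have h' (a b : A.sections) : A.twist hX a b = (2 : ℝ) • Ω.apply a b := by
    rw [h, smul_smul, mul_one_div_cancel two_ne_zero, one_smul]
  have c1 (a b c : A.sections) :
      (A.bracket (Ω.apply a b) c + Ω.apply (A.bracket a b) c) +
      (A.bracket (Ω.apply b c) a + Ω.apply (A.bracket b c) a) +
      (A.bracket (Ω.apply c a) b + Ω.apply (A.bracket c a) b) = 0 := by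
    have h1 := cyclic_twist A.bracket (A.fallingOn hX) A.isLie.add_left A.isLie.jacobi
      (A.fallingOn_add hX) (A.twist hX) (fun _ _ => rfl) a b c
    simp only [h', A.isLie.smul_left, ← smul_add] at h1
    exact (smul_eq_zero.1 h1).resolve_left two_ne_zero
  have c2 (a b c : A.sections) := cyclic_twist_twist A.bracket (A.fallingOn hX) A.isLie.add_left
    A.isLie.jacobi (A.fallingOn_add hX) (A.twist hX) (A.torsion hX) (fun _ _ => rfl)
    (fun _ _ => rfl) a b c
  simp only [h', Ω.apply_const_smul_left, ← smul_add] at c2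
  -- The Jacobiator is a quadratic polynomial in `ε`; its constant term vanishes by Jacobi for `A`
  -- and its linear term by the cocycle identity `c1`.
  have jac (ε : ℝ) (a b c : A.sections) :
      (A.bracket (A.bracket a b + ε • Ω.apply a b) c +
        ε • Ω.apply (A.bracket a b + ε • Ω.apply a b) c) +
      (A.bracket (A.bracket b c + ε • Ω.apply b c) a +
        ε • Ω.apply (A.bracket b c + ε • Ω.apply b c) a) +
      (A.bracket (A.bracket c a + ε • Ω.apply c a) b +
        ε • Ω.apply (A.bracket c a + ε • Ω.apply c a) b) =
      (ε * ε) • (Ω.apply (Ω.apply a b) c + Ω.apply (Ω.apply b c) a +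
        Ω.apply (Ω.apply c a) b) := by
    simp only [A.isLie.add_left, A.isLie.smul_left, Ω.apply_add_left, Ω.apply_const_smul_left]
    linear_combination (norm := module) A.isLie.jacobi a b c + ε • c1 a b c
  constructor
  · intro hΩ a b c
    -- Only the `ε²` term survives, so the single value `ε = 1` suffices.
    have h1 := (hΩ 1).jacobi a b c
    rw [jac 1 a b c, one_mul, one_smul] at h1
    rw [← c2, h1, smul_zero, smul_zero]
  · intro hT ε
    have c3 (a b c : A.sections) : Ω.apply (Ω.apply a b) c + Ω.apply (Ω.apply b c) a +
        Ω.apply (Ω.apply c a) b = 0 := by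
      have h1 := (c2 a b c).trans (hT a b c)
      rw [smul_smul] at h1
      exact (smul_eq_zero.1 h1).resolve_left (by norm_num)
    refine ⟨fun a b c => ?_, fun r a b => ?_, fun a b => ?_, fun a b c => ?_, fun a f b => ?_,
      fun a b => ?_⟩
    · rw [A.isLie.add_right, Ω.apply_add_right, smul_add]
      abel
    · rw [A.isLie.smul_right, Ω.apply_const_smul_right, smul_comm ε, smul_add]
    · rw [A.isLie.skew, Ω.apply_skew, smul_neg]
      abel
    · rw [jac, c3, smul_zero]
    · rw [A.isLie.leibniz, Ω.apply_smul_right, smul_comm ε, smul_add]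
      abel
    · change (A.bracket a b).1.1 + ε • (0 : VF I M) = _
      rw [smul_zero, add_zero, A.isLie.anchor]

end Falling

/-! ### The lifted Dirac structure covers `A` -/

/-- Both sides of the defining condition of `L^A` vanish. These elements of `L^A` are the test
elements that detect membership in `A`. -/
theorem annihilator_mem_lift {h : HomTE I F E} (hA : ∀ m, ∀ v ∈ A.fibre m, h.toFun m v = 0) :
    h.a ∈ A.lift := by
  have hp : h.a.b ∈ A.sections := by
    rw [h.b_a]; exact A.sections.zero_mem
  refine (A.mem_lift_iff _).2 ⟨hp, fun Y hY => ?_⟩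
  have h0 : (⟨h.a.b, hp⟩ : A.sections) = 0 := Subtype.ext h.b_a
  rw [h0, A.isLie.zero_left, h.b_a_dorfman, Subbundle.annihilator_apply hA hY]
  rfl

/-- For any `Y` over `a`, the derivations `[a, ·]_A` and `Ȳ` have the same symbol and the same
`TM`-component on `Γ(A)`. Their difference is a bundle map `A → E`; extended to `TM ⊕ E` and added
to `Y`, it corrects `Ȳ` without changing `𝐛 Y`. -/
theorem exists_lift (a : A.sections) : ∃ l ∈ A.lift, l.b = a.1 := by
  obtain ⟨Y, hY⟩ := OmniSec.exists_b_eq a.1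
  let D : A.sections →ₗ[C^∞⟮I, M; ℝ⟯] Cₛ^∞⟮I; F, E⟯ :=
    { toFun := fun t => (A.bracket a t).1.2 - (Y.falling t.1).2
      map_add' := fun s t => by
        rw [A.isLie.add_right, Submodule.coe_add, Submodule.coe_add, OmniSec.falling_add]
        exact add_sub_add_comm _ _ _ _
      map_smul' := fun f t => by
        have h1 : Y.1.anchor = a.1.1 := congrArg Prod.fst hY
        rw [A.isLie.leibniz, Submodule.coe_smul f t, OmniSec.falling_smul, h1, RingHom.id_apply,
          smul_sub]
        exact add_sub_add_right_eq_sub _ _ _ }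
  obtain ⟨h, hD⟩ := A.exists_homTE_extension D
  have hb : (Y + h.a).b = a.1 := by
    rw [OmniSec.b_add, h.b_a, hY, add_zero]
  have hp : (Y + h.a).b ∈ A.sections := by
    rw [hb]; exact a.2
  refine ⟨Y + h.a, (A.mem_lift_iff _).2 ⟨hp, fun Z hZ => ?_⟩, hb⟩
  have ha : (⟨(Y + h.a).b, hp⟩ : A.sections) = a := Subtype.ext hb
  have hDZ : h.apply Z.b = (A.bracket a ⟨Z.b, hZ⟩).1.2 - (Y.falling Z.b).2 := hD ⟨Z.b, hZ⟩
  rw [ha, OmniSec.b_add_dorfman, h.b_a_dorfman, hDZ, ← OmniSec.falling_b]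
  refine Prod.ext ?_ (add_sub_cancel _ _)
  rw [A.isLie.anchor, Prod.fst_add, OmniSec.falling_fst, hY]
  exact add_zero _

theorem dLift_omega (X : OmniSec I F E) (l₁ l₂ : A.LiftSec) :
    A.dLift (A.omega X) l₁ l₂ = - (X.dorfman l₁.1).pairing l₂.1 :=
  X.op_pairing_sub l₁.1 l₂.1

/-- Only the left argument has to be in `L^A`; the right one may be any section over `b`, which
leaves room for sections such as `{X, l}`. -/
theorem bracket_lift {l Y : OmniSec I F E} (hl : l ∈ A.lift) {a b : A.sections} (ha : l.b = a.1)
    (hb : Y.b = b.1) : (A.bracket a b).1 = (l.dorfman Y).b := by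
  obtain ⟨h1, h2⟩ := (A.mem_lift_iff l).1 hl
  have hY : Y ∈ A.preimage := by
    change Y.b ∈ A.sections
    rw [hb]; exact b.2
  rw [h2 Y hY]
  congr 2 <;> exact Subtype.ext (by simp only [ha, hb])

/-- The coboundary of `X̄` in terms of lifts. -/
theorem twist_lift {X : OmniSec I F E} (hX : X ∈ OmniSec.normalizer A.preimage)
    (l₁ l₂ : A.LiftSec) :
    (A.twist hX ⟨l₁.1.b, A.lift_subset l₁.2⟩ ⟨l₂.1.b, A.lift_subset l₂.2⟩).1 =
      (0, (2 : ℝ) • A.dLift (A.omega X) l₁ l₂) := by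
  -- `{X, l₁}` lies over `X̄𝐛l₁` but need not be in `L^A`, so it is put in the right slot, and
  -- skew-symmetry is used below.
  have e1 := A.bracket_lift l₂.2 (Y := X.dorfman l₁.1) (a := ⟨l₂.1.b, A.lift_subset l₂.2⟩)
    (b := A.fallingOn hX ⟨l₁.1.b, A.lift_subset l₁.2⟩) rfl (X.falling_b l₁.1).symm
  have e2 := A.bracket_lift l₁.2 (Y := X.dorfman l₂.1) (a := ⟨l₁.1.b, A.lift_subset l₁.2⟩)
    (b := A.fallingOn hX ⟨l₂.1.b, A.lift_subset l₂.2⟩) rfl (X.falling_b l₂.1).symm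
  have e3 := A.bracket_lift l₁.2 (Y := l₂.1) (a := ⟨l₁.1.b, A.lift_subset l₁.2⟩)
    (b := ⟨l₂.1.b, A.lift_subset l₂.2⟩) rfl rfl
  have e4 : (A.fallingOn hX (A.bracket ⟨l₁.1.b, A.lift_subset l₁.2⟩
      ⟨l₂.1.b, A.lift_subset l₂.2⟩)).1 = (X.dorfman (l₁.1.dorfman l₂.1)).b := by
    rw [← X.falling_b, ← e3]; rfl
  rw [dLift_omega, twist, A.isLie.skew _ ⟨l₂.1.b, A.lift_subset l₂.2⟩, Submodule.coe_sub,
    Submodule.coe_add, Submodule.coe_neg, e1, e2, e4, X.b_dorfman_leibniz l₁.1 l₂.1]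
  -- After the Leibniz identity the term `{l₁, {X, l₂}}` cancels, and what is left is minus the
  -- symmetrized bracket of `{X, l₁}` and `l₂`.
  have h := (X.dorfman l₁.1).b_dorfman_add_swap l₂.1
  have h2 : ((0, (2 : ℝ) • -(X.dorfman l₁.1).pairing l₂.1) : TSec I F E) =
      -(0, (2 : ℝ) • (X.dorfman l₁.1).pairing l₂.1) := by
    rw [smul_neg]; exact Prod.ext neg_zero.symm rfl
  rw [h2, ← h]
  abel

theorem half_twist_lift {X : OmniSec I F E} (hX : X ∈ OmniSec.normalizer A.preimage)
    (l₁ l₂ : A.LiftSec) :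
    ((1 / 2 : ℝ) • A.twist hX ⟨l₁.1.b, A.lift_subset l₁.2⟩ ⟨l₂.1.b, A.lift_subset l₂.2⟩).1 =
      (0, A.dLift (A.omega X) l₁ l₂) := by
  refine (congrArg ((1 / 2 : ℝ) • ·) (A.twist_lift hX l₁ l₂)).trans (Prod.ext (smul_zero _) ?_)
  change (1 / 2 : ℝ) • (2 : ℝ) • _ = _
  rw [smul_smul, one_div_mul_cancel two_ne_zero, one_smul]

theorem exists_liftSec (a : A.sections) :
    ∃ l : A.LiftSec, (⟨l.1.b, A.lift_subset l.2⟩ : A.sections) = a := by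
  obtain ⟨l, hl, h⟩ := A.exists_lift a
  exact ⟨⟨l, hl⟩, Subtype.ext h⟩

/-- With an element of `A⁰` as second argument, `𝐛*Ω` vanishes while the coboundary is minus half
its value on `𝐛{X, l}`. So `𝐛{X, l}` is annihilated by `A⁰` and lies in `A`. -/
theorem mem_normalizer_of_pullback_eq [Nontrivial F] {Ω : A.TwoForm} {X : OmniSec I F E}
    (h : A.pullback Ω = A.dLift (A.omega X)) : X ∈ OmniSec.normalizer A.preimage := by
  intro Y hY
  obtain ⟨l, hl, hlb⟩ := A.exists_lift ⟨Y.b, hY⟩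
  change (X.dorfman Y).b ∈ A.sections
  have hlb' : l.b = Y.b := hlb
  -- `𝐛{X, Y}` depends on `Y` only through `𝐛 Y`, so `Y` may be replaced by a lift in `L^A`.
  rw [← X.falling_b, ← hlb', X.falling_b]
  refine A.mem_sections_of_annihilator fun k hk => smul_half_eq_zero ?_
  have h1 := congrFun (congrFun h ⟨l, hl⟩) ⟨k.a, A.annihilator_mem_lift hk⟩
  rw [dLift_omega] at h1
  change _ = - (X.dorfman l).pairing k.a at h1
  rw [k.pairing_a_right] at h1
  have h2 : A.pullback Ω ⟨l, hl⟩ ⟨k.a, A.annihilator_mem_lift hk⟩ = 0 := by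
    ext m
    have h3 : (⟨k.a.b.eval m, A.lift_subset (A.annihilator_mem_lift hk) m⟩ : A.fibre m) = 0 :=
      Subtype.ext (congrArg (fun t : TSec I F E => t.eval m) k.b_a)
    change Ω.toFun m _ ⟨k.a.b.eval m, A.lift_subset (A.annihilator_mem_lift hk) m⟩ = 0
    rw [h3, map_zero]
  rw [h2] at h1
  exact neg_eq_zero.1 h1.symm

/-- `L^A` covers `A`, so a two-form on `A` is determined by its pullback. -/
theorem apply_eq_half_twist {Ω : A.TwoForm} {X : OmniSec I F E}
    (h : A.pullback Ω = A.dLift (A.omega X)) (hX : X ∈ OmniSec.normalizer A.preimage)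
    (a b : A.sections) : Ω.apply a b = (1 / 2 : ℝ) • A.twist hX a b := by
  obtain ⟨l₁, rfl⟩ := A.exists_liftSec a
  obtain ⟨l₂, rfl⟩ := A.exists_liftSec b
  refine Subtype.ext ?_
  rw [half_twist_lift, ← h]
  rfl

theorem pullback_eq_of_apply {Ω : A.TwoForm} {X : OmniSec I F E}
    (hX : X ∈ OmniSec.normalizer A.preimage)
    (h : ∀ a b, Ω.apply a b = (1 / 2 : ℝ) • A.twist hX a b) :
    A.pullback Ω = A.dLift (A.omega X) := by
  funext l₁ l₂
  have h1 := congrArg Subtype.val (h ⟨l₁.1.b, A.lift_subset l₁.2⟩ ⟨l₂.1.b, A.lift_subset l₂.2⟩)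
  rw [half_twist_lift] at h1
  exact congrArg Prod.snd h1

end ProjLieAlgebroid

/-- A skew-symmetric bracket on `Γ(A)` with values in `Γ(A ∩ E)` that is linear over functions
is given by a bundle map. -/
theorem Subbundle.exists_twoForm (A : Subbundle I F E) (T : A.sections → A.sections → A.sections)
    (add_right : ∀ a b c, T a (b + c) = T a b + T a c)
    (smul_right : ∀ a (f : C^∞⟮I, M; ℝ⟯) b, T a (f • b) = f • T a b)
    (skew : ∀ a b, T a b = - T b a) (hE : ∀ a b, (T a b).1.1 = 0) :
    ∃ Ω : A.TwoForm, ∀ a b, Ω.apply a b = T a b := by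
  -- Linearity over functions in the second slot makes the value depend only on the value of `b` at
  -- `m`; skew-symmetry carries this to the first slot. The fibre map may then be computed with
  -- arbitrary sections `s m v` through the given vectors.
  have right {m : M} (a : A.sections) {b b' : A.sections} (h : b.1.eval m = b'.1.eval m) :
      (T a b).1.2 m = (T a b').1.2 m := by
    let Q : A.sections →+ TSec I F E := AddMonoidHom.mk' (fun b => (T a b).1) fun b c => by
      rw [add_right]; rfl
    have h1 := A.eval_eq_zero Q (fun f t => by
      change (T a (f • t)).1 = f • (T a t).1
      rw [smul_right]; rfl) m (b - b') (sub_eq_zero.2 h)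
    rw [map_sub, TSec.eval_sub] at h1
    exact congrArg Prod.snd (sub_eq_zero.1 h1)
  have skew' (m : M) (a b : A.sections) : (T a b).1.2 m = - (T b a).1.2 m := by
    rw [skew]; rfl
  have left {m : M} {a a' : A.sections} (b : A.sections) (h : a.1.eval m = a'.1.eval m) :
      (T a b).1.2 m = (T a' b).1.2 m := by
    rw [skew' m a, skew' m a', right b h]
  choose s hs using fun (m : M) (v : A.fibre m) => A.exists_eval_eq v.2
  have hadd (m : M) (a b c : A.sections) :
      (T a (b + c)).1.2 m = (T a b).1.2 m + (T a c).1.2 m := by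
    rw [add_right]; rfl
  have hsmul (m : M) (r : ℝ) (a b : A.sections) :
      (T a (algebraMap ℝ C^∞⟮I, M; ℝ⟯ r • b)).1.2 m = r • (T a b).1.2 m := by
    rw [smul_right]; rfl
  have hsadd (m : M) (v w : A.fibre m) : (s m (v + w)).1.eval m = (s m v + s m w).1.eval m := by
    rw [hs, Submodule.coe_add, Submodule.coe_add, TSec.eval_add, hs, hs]
  have hssmul (m : M) (r : ℝ) (v : A.fibre m) :
      (s m (r • v)).1.eval m = (algebraMap ℝ C^∞⟮I, M; ℝ⟯ r • s m v).1.eval m := by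
    rw [hs, Submodule.coe_smul, Submodule.coe_smul, TSec.eval_smul, hs]
    rfl
  let φ (m : M) : A.fibre m →ₗ[ℝ] A.fibre m →ₗ[ℝ] E m :=
    LinearMap.mk₂ ℝ (fun v w => (T (s m v) (s m w)).1.2 m)
      (fun v v' w => by
        rw [left _ (hsadd m v v'), skew', hadd, neg_add, ← skew', ← skew'])
      (fun r v w => by rw [left _ (hssmul m r v), skew', hsmul, ← smul_neg, ← skew'])
      (fun v w w' => by rw [right _ (hsadd m w w'), hadd])
      (fun r v w => by rw [right _ (hssmul m r w), hsmul])
  have hφ (m : M) (a b : A.sections) :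
      φ m ⟨a.1.eval m, a.2 m⟩ ⟨b.1.eval m, b.2 m⟩ = (T a b).1.2 m :=
    (left _ (hs m _)).trans (right _ (hs m _))
  refine ⟨⟨φ, fun m v => ?_, fun m v w => ?_, fun a b => ?_⟩, fun a b => ?_⟩
  · have h1 := eq_neg_iff_add_eq_zero.1 (skew' m (s m v) (s m v))
    rw [← two_smul ℝ] at h1
    exact (smul_eq_zero.1 h1).resolve_left two_ne_zero
  · have h1 := (T (s m v) (s m w)).2 m
    have h2 : (T (s m v) (s m w)).1.eval m = (0, φ m v w) :=
      Prod.ext (congrArg (fun x : VF I M => x m) (hE _ _)) rfl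
    rwa [h2] at h1
  · simp only [hφ]
    exact (T a b).1.2.contMDiff
  · refine Subtype.ext (Prod.ext (hE a b).symm ?_)
    ext m
    exact hφ m a b

end Main

end OmniLie

end

/-! ### Assembly of the proposition -/

theorem proposition6p5
    {B : Type*} [NormedAddCommGroup B] [NormedSpace ℝ B] [FiniteDimensional ℝ B]
    {H : Type*} [TopologicalSpace H] {I : ModelWithCorners ℝ B H}
    {M : Type*} [TopologicalSpace M] [ChartedSpace H M] [IsManifold I ∞ M]
    [BoundarylessManifold I M] [T2Space M] [SigmaCompactSpace M]
    {F : Type*} [NormedAddCommGroup F] [NormedSpace ℝ F] [FiniteDimensional ℝ F] [Nontrivial F]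
    {E : M → Type*} [TopologicalSpace (TotalSpace F E)]
    [∀ x, AddCommGroup (E x)] [∀ x, Module ℝ (E x)] [∀ x : M, TopologicalSpace (E x)]
    [FiberBundle F E] [VectorBundle ℝ F E] [ContMDiffVectorBundle ∞ F E I]
    (A : OmniLie.ProjLieAlgebroid I F E) :
    OmniLie.OmniSec.normalizer A.annihilator = OmniLie.OmniSec.normalizer A.preimage ∧
    (∀ (Ω : A.TwoForm) (X : OmniLie.OmniSec I F E), A.pullback Ω = A.dLift (A.omega X) →
      ∃ hX : X ∈ OmniLie.OmniSec.normalizer A.preimage,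
        (∀ a₁ a₂ : A.sections, Ω.apply a₁ a₂ = (1 / 2 : ℝ) •
          (A.bracket (A.fallingOn hX a₁) a₂ + A.bracket a₁ (A.fallingOn hX a₂)
            - A.fallingOn hX (A.bracket a₁ a₂))) ∧
        (A.GeneratesDeformation Ω ↔ A.TorsionCyclic hX)) ∧
    (∀ (X : OmniLie.OmniSec I F E) (hX : X ∈ OmniLie.OmniSec.normalizer A.preimage), A.TorsionCyclic hX →
      ∃ Ω : A.TwoForm,
        (∀ a₁ a₂ : A.sections, Ω.apply a₁ a₂ = (1 / 2 : ℝ) •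
          (A.bracket (A.fallingOn hX a₁) a₂ + A.bracket a₁ (A.fallingOn hX a₂)
            - A.fallingOn hX (A.bracket a₁ a₂))) ∧
        A.GeneratesDeformation Ω ∧ A.pullback Ω = A.dLift (A.omega X)) := by
  refine ⟨A.normalizer_annihilator, fun Ω X h => ?_, fun X hX hT => ?_⟩
  · have hX := A.mem_normalizer_of_pullback_eq h
    have h2 := A.apply_eq_half_twist h hX
    exact ⟨hX, h2, A.generatesDeformation_iff hX Ω h2⟩
  · obtain ⟨Ω, h2⟩ := A.exists_twoForm (fun a b => (1 / 2 : ℝ) • A.twist hX a b)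
      (fun a b c => by rw [A.twist_add_right, smul_add])
      (fun a f b => by rw [A.twist_smul_right, smul_comm])
      (fun a b => by rw [A.twist_skew, smul_neg])
      -- The twist has no `TM`-component: over lifts it is a value of the `E`-valued form `d ω_X`.
      (fun a b => by
        obtain ⟨l₁, rfl⟩ := A.exists_liftSec a
        obtain ⟨l₂, rfl⟩ := A.exists_liftSec b
        rw [A.half_twist_lift])
    exact ⟨Ω, h2, (A.generatesDeformation_iff hX Ω h2).2 hT, A.pullback_eq_of_apply hX h2⟩
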